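/- All spaces are over $\mathbb{R}$. Let $1 \le p \le \infty$, let $p'$ be the conjugate exponent ($1/p + 1/p' = 1$), and write $\ell^p_n$ for $\mathbb{R}^n$ with the $\ell^p$ norm. A \emph{$p$-multinormed space} is a Banach space $X$ together with norms $\|\cdot\|_n$ on $\ell^p_n \otimes X$ ($n \in \mathbb{N}$) such that (1) $\|a \otimes x\|_n = \|a\|\,\|x\|$ for $a \in \ell^p_n$, $x \in X$; (2) $|\langle a^* \otimes x^*, u\rangle| \le \|u\|_n$ for $u \in \ell^p_n \otimes X$ and all functionals $a^* \in (\ell^p_n)^*$, $x^* \in X^*$ of norm at most $1$; (3) $\|(T \otimes I_X)u\|_m \le \|T\|\,\|u\|_n$ for every linear operator $T : \ell^p_n \to \ell^p_m$ and $u \in \ell^p_n \otimes X$. A closed subspace of a $p$-multinormed space carries the restricted norms. For a linear map $u : X \to Y$ between $p$-multinormed spaces put $\|u\|_p = \sup_n \|I_{\ell^p_n} \otimes u : \ell^p_n \otimes X \to \ell^p_n \otimes Y\|$; $u$ is \emph{$p$-multibounded} if $\|u\|_p < \infty$. For a Banach space $E$, $\max_p(E)$ denotes $E$ with the $p$-multinorm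 given by the projective tensor norms on $\ell^p_n \otimes E$. A $p$-multinormed space $Z$ is \emph{$c$-injective} if for every $p$-multinormed space $Y$, every closed subspace $X \subseteq Y$ (with the restricted norms) and every $p$-multibounded $u : X \to Z$ there is a linear map $\tilde u : Y \to Z$ with $\tilde u|_X = u$ and $\|\tilde u\|_p \le c\,\|u\|_p$. \textbf{Corollary.} If $(\Omega,\mu)$ is a $\sigma$-finite measure space, then $\max_p(L^{p'}(\mu))$ is $1$-injective as a $p$-multinormed space. -/

import Mathlib

open scoped TensorProduct ENNReal NNReal

universe v w

noncomputable section

/-- The finite-dimensional space `ℓ^p_n`, i.e. `ℝⁿ` with the `ℓ^p` norm. -/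
abbrev EllP (p : ℝ≥0∞) (n : ℕ) : Type := PiLp p (fun _ : Fin n => ℝ)

section Projective

variable {E F : Type*} [NormedAddCommGroup E] [NormedSpace ℝ E]
  [NormedAddCommGroup F] [NormedSpace ℝ F]

/-- The costs `∑ ‖aᵢ‖ ‖xᵢ‖` of the finite representations `u = ∑ aᵢ ⊗ xᵢ`. -/
def projCosts (u : E ⊗[ℝ] F) : Set ℝ :=
  {r | ∃ (k : ℕ) (a : Fin k → E) (x : Fin k → F),
    u = ∑ i, a i ⊗ₜ[ℝ] x i ∧ r = ∑ i, ‖a i‖ * ‖x i‖}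

/-- The projective tensor norm on the algebraic tensor product `E ⊗ F`. -/
def projNorm (u : E ⊗[ℝ] F) : ℝ := sInf (projCosts u)

theorem projCosts_nonempty (u : E ⊗[ℝ] F) : (projCosts u).Nonempty := by
  obtain ⟨k, a, x, h⟩ := TensorProduct.exists_sum_tmul_eq u
  exact ⟨_, k, a, x, h, rfl⟩

theorem projCosts_nonneg {u : E ⊗[ℝ] F} {r : ℝ} (hr : r ∈ projCosts u) : 0 ≤ r := by
  obtain ⟨k, a, x, -, rfl⟩ := hr
  positivity

theorem projNorm_le {u : E ⊗[ℝ] F} {r : ℝ} (hr : r ∈ projCosts u) : projNorm u ≤ r :=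
  csInf_le ⟨0, fun _ h => projCosts_nonneg h⟩ hr

theorem projNorm_tmul_le (a : E) (x : F) : projNorm (a ⊗ₜ[ℝ] x) ≤ ‖a‖ * ‖x‖ :=
  projNorm_le ⟨1, fun _ => a, fun _ => x, by simp, by simp⟩

theorem projNorm_zero : projNorm (0 : E ⊗[ℝ] F) = 0 :=
  le_antisymm (projNorm_le ⟨0, 0, 0, by simp, by simp⟩)
    (le_csInf (projCosts_nonempty _) fun _ h => projCosts_nonneg h)

theorem projNorm_add_le (u v : E ⊗[ℝ] F) : projNorm (u + v) ≤ projNorm u + projNorm v := by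
  have key : ∀ r ∈ projCosts u, ∀ s ∈ projCosts v, projNorm (u + v) ≤ r + s := by
    rintro _ ⟨k, a, x, hu, rfl⟩ _ ⟨l, b, y, hv, rfl⟩
    refine projNorm_le ⟨k + l, Fin.append a b, Fin.append x y, ?_, ?_⟩
    · rw [Fin.sum_univ_add, hu, hv]; simp
    · rw [Fin.sum_univ_add]; simp
  have h1 : ∀ r ∈ projCosts u, projNorm (u + v) - r ≤ projNorm v := fun r hr =>
    le_csInf (projCosts_nonempty v) fun s hs => by linarith [key r hr s hs]
  have h2 : projNorm (u + v) - projNorm v ≤ projNorm u :=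
    le_csInf (projCosts_nonempty u) fun r hr => by linarith [h1 r hr]
  linarith

/-- Operators act on the left factor with their operator norm. -/
theorem projNorm_map_le {E' : Type*} [NormedAddCommGroup E'] [NormedSpace ℝ E']
    (T : E →L[ℝ] E') (u : E ⊗[ℝ] F) :
    projNorm (TensorProduct.map T.toLinearMap LinearMap.id u) ≤ ‖T‖ * projNorm u := by
  have h0 : ∀ r ∈ projCosts u,
      projNorm (TensorProduct.map T.toLinearMap LinearMap.id u) ≤ ‖T‖ * r := by
    rintro _ ⟨k, a, x, hu, rfl⟩
    refine (projNorm_le ⟨k, fun i => T (a i), x, by simp [hu], rfl⟩).trans ?_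
    rw [Finset.mul_sum]
    refine Finset.sum_le_sum fun i _ => ?_
    rw [← mul_assoc]
    exact mul_le_mul_of_nonneg_right (T.le_opNorm _) (norm_nonneg _)
  rcases (norm_nonneg T).eq_or_lt with hT | hT
  · obtain ⟨r, hr⟩ := projCosts_nonempty u
    simpa [← hT] using h0 r hr
  · rw [← div_le_iff₀' hT]
    exact le_csInf (projCosts_nonempty u) fun r hr => (div_le_iff₀' hT).2 (h0 r hr)

theorem projNorm_smul_le (c : ℝ) (u : E ⊗[ℝ] F) : projNorm (c • u) ≤ ‖c‖ * projNorm u := by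
  have h := projNorm_map_le (c • ContinuousLinearMap.id ℝ E) u
  have e : TensorProduct.map (c • ContinuousLinearMap.id ℝ E).toLinearMap
      (LinearMap.id : F →ₗ[ℝ] F) u = c • u := by
    simp [TensorProduct.map_smul_left]
  rw [e] at h
  refine h.trans (mul_le_mul_of_nonneg_right ?_
    (le_csInf (projCosts_nonempty _) fun _ h => projCosts_nonneg h))
  refine ContinuousLinearMap.opNorm_le_bound _ (norm_nonneg _) fun a => ?_
  simp [norm_smul]

/-- The projective tensor norm as a seminorm. -/
def projSeminorm (E F : Type*) [NormedAddCommGroup E] [NormedSpace ℝ E]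
    [NormedAddCommGroup F] [NormedSpace ℝ F] : Seminorm ℝ (E ⊗[ℝ] F) :=
  Seminorm.ofSMulLE projNorm projNorm_zero projNorm_add_le projNorm_smul_le

/-- The functional `a* ⊗ x*` on `E ⊗ F`: `a ⊗ x ↦ ⟨a*, a⟩ ⟨x*, x⟩`. -/
def tensorPairing (φ : StrongDual ℝ E) (ψ : StrongDual ℝ F) : E ⊗[ℝ] F →ₗ[ℝ] ℝ :=
  LinearMap.mul' ℝ ℝ ∘ₗ TensorProduct.map φ.toLinearMap ψ.toLinearMap

@[simp]
theorem tensorPairing_tmul (φ : StrongDual ℝ E) (ψ : StrongDual ℝ F) (a : E) (x : F) :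
    tensorPairing φ ψ (a ⊗ₜ[ℝ] x) = φ a * ψ x := by
  simp [tensorPairing]

theorem tensorPairing_le_projNorm (φ : StrongDual ℝ E) (ψ : StrongDual ℝ F) (hφ : ‖φ‖ ≤ 1)
    (hψ : ‖ψ‖ ≤ 1) (u : E ⊗[ℝ] F) : |tensorPairing φ ψ u| ≤ projNorm u := by
  refine le_csInf (projCosts_nonempty u) ?_
  rintro _ ⟨k, a, x, rfl, rfl⟩
  rw [map_sum]
  refine (Finset.abs_sum_le_sum_abs _ _).trans (Finset.sum_le_sum fun i _ => ?_)
  rw [tensorPairing_tmul, abs_mul]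
  have h1 : |φ (a i)| ≤ ‖a i‖ := φ.le_of_opNorm_le hφ (a i) |>.trans_eq (one_mul _)
  have h2 : |ψ (x i)| ≤ ‖x i‖ := ψ.le_of_opNorm_le hψ (x i) |>.trans_eq (one_mul _)
  exact mul_le_mul h1 h2 (abs_nonneg _) (norm_nonneg _)

theorem projNorm_tmul (a : E) (x : F) : projNorm (a ⊗ₜ[ℝ] x) = ‖a‖ * ‖x‖ := by
  refine le_antisymm (projNorm_tmul_le a x) ?_
  obtain ⟨φ, hφ, ha⟩ := exists_dual_vector'' ℝ a
  obtain ⟨ψ, hψ, hx⟩ := exists_dual_vector'' ℝ x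
  have h := tensorPairing_le_projNorm φ ψ hφ hψ (a ⊗ₜ[ℝ] x)
  rw [tensorPairing_tmul, ha, hx] at h
  exact (le_abs_self _).trans h

end Projective

/-- A `p`-multinorm structure on a Banach space `X`: a tensorial sequence of cross-norms
`‖·‖_n` on the spaces `ℓ^p_n ⊗ X`. That each `‖·‖_n` separates points, and so is a norm, follows
from `pairing_le`; see `PMultinorm.eq_zero_of_norm_eq_zero`. -/
structure PMultinorm (p : ℝ≥0∞) [Fact (1 ≤ p)] (X : Type*) [NormedAddCommGroup X]
    [NormedSpace ℝ X] [CompleteSpace X] where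
  /-- the norm on `ℓ^p_n ⊗ X` -/
  norm : ∀ n : ℕ, Seminorm ℝ (EllP p n ⊗[ℝ] X)
  norm_tmul : ∀ (n : ℕ) (a : EllP p n) (x : X), norm n (a ⊗ₜ[ℝ] x) = ‖a‖ * ‖x‖
  pairing_le : ∀ (n : ℕ) (φ : StrongDual ℝ (EllP p n)) (ψ : StrongDual ℝ X),
    ‖φ‖ ≤ 1 → ‖ψ‖ ≤ 1 → ∀ u : EllP p n ⊗[ℝ] X, |tensorPairing φ ψ u| ≤ norm n u
  norm_map_le : ∀ (n m : ℕ) (T : EllP p n →L[ℝ] EllP p m) (u : EllP p n ⊗[ℝ] X),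
    norm m (TensorProduct.map T.toLinearMap LinearMap.id u) ≤ ‖T‖ * norm n u

namespace PMultinorm

variable {p : ℝ≥0∞} [Fact (1 ≤ p)]
  {X : Type*} [NormedAddCommGroup X] [NormedSpace ℝ X] [CompleteSpace X]
  {Y : Type*} [NormedAddCommGroup Y] [NormedSpace ℝ Y] [CompleteSpace Y]

theorem eq_zero_of_norm_eq_zero (N : PMultinorm p X) (n : ℕ) (u : EllP p n ⊗[ℝ] X)
    (hu : N.norm n u = 0) : u = 0 := by
  have key : ∀ (φ : StrongDual ℝ (EllP p n)) (ψ : StrongDual ℝ X), tensorPairing φ ψ u = 0 := by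
    intro φ ψ
    set c : ℝ := ‖φ‖ + 1
    set d : ℝ := ‖ψ‖ + 1
    have hc : 0 < c := by positivity
    have hd : 0 < d := by positivity
    have h := N.pairing_le n (c⁻¹ • φ) (d⁻¹ • ψ)
      (by rw [norm_smul, norm_inv, Real.norm_of_nonneg hc.le, inv_mul_le_iff₀ hc]; simp [c])
      (by rw [norm_smul, norm_inv, Real.norm_of_nonneg hd.le, inv_mul_le_iff₀ hd]; simp [d]) u
    rw [hu] at h
    have h' := abs_nonpos_iff.1 h
    have e : tensorPairing (c⁻¹ • φ) (d⁻¹ • ψ) u = c⁻¹ * d⁻¹ * tensorPairing φ ψ u := by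
      clear h h' hu
      induction u using TensorProduct.induction_on with
      | zero => simp
      | tmul a x => simp; ring
      | add u v hu hv => rw [map_add, map_add, hu, hv]; ring
    rw [e] at h'
    have : c⁻¹ * d⁻¹ ≠ 0 := by positivity
    exact (mul_eq_zero.1 h').resolve_left this
  obtain ⟨k, a, x, rfl⟩ := TensorProduct.exists_sum_tmul_eq u
  have hbasis : ∀ b : EllP p n,
      b = ∑ j, b j • (WithLp.toLp p (Pi.single j (1 : ℝ)) : EllP p n) := by
    intro b
    ext i
    simp [Finset.sum_apply, Pi.single_apply]
  have hz : ∀ j, ∑ i, a i j • x i = 0 := by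
    intro j
    obtain ⟨ψ, -, hψ⟩ := exists_dual_vector'' ℝ (∑ i, a i j • x i)
    have h := key (PiLp.proj p (fun _ : Fin n => ℝ) j) ψ
    rw [map_sum] at h
    simp only [tensorPairing_tmul, PiLp.proj_apply] at h
    rw [map_sum] at hψ
    simp only [map_smul, smul_eq_mul] at hψ
    rw [h] at hψ
    exact norm_eq_zero.1 (by simpa using hψ.symm)
  calc ∑ i, a i ⊗ₜ[ℝ] x i
      = ∑ i, ∑ j, (WithLp.toLp p (Pi.single j (1 : ℝ)) : EllP p n) ⊗ₜ[ℝ] (a i j • x i) := by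
        refine Finset.sum_congr rfl fun i _ => ?_
        conv_lhs => rw [hbasis (a i), TensorProduct.sum_tmul]
        simp only [TensorProduct.smul_tmul]
    _ = ∑ j, (WithLp.toLp p (Pi.single j (1 : ℝ)) : EllP p n) ⊗ₜ[ℝ] (∑ i, a i j • x i) := by
        rw [Finset.sum_comm]
        simp only [TensorProduct.tmul_sum]
    _ = 0 := by simp [hz]

/-- The map `I_{ℓ^p_n} ⊗ u`. -/
def ampl (p : ℝ≥0∞) (n : ℕ) {X Y : Type*} [AddCommGroup X] [Module ℝ X]
    [AddCommGroup Y] [Module ℝ Y] (u : X →ₗ[ℝ] Y) : EllP p n ⊗[ℝ] X →ₗ[ℝ] EllP p n ⊗[ℝ] Y :=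
  TensorProduct.map LinearMap.id u

/-- The `p`-norm `‖u‖_p = sup_n ‖I_{ℓ^p_n} ⊗ u‖` of a linear map, with value `∞` if the
supremum is not finite. -/
def pNorm (NX : PMultinorm p X) (NY : PMultinorm p Y) (u : X →ₗ[ℝ] Y) : ℝ≥0∞ :=
  ⨆ (n : ℕ) (t : EllP p n ⊗[ℝ] X) (_ : NX.norm n t ≤ 1), ENNReal.ofReal (NY.norm n (ampl p n u t))

/-- `u` is `p`-multibounded if its `p`-norm is finite. -/
def IsMultibounded (NX : PMultinorm p X) (NY : PMultinorm p Y) (u : X →ₗ[ℝ] Y) : Prop :=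
  pNorm NX NY u < ∞

/-- A closed subspace `X` of `Y` with the `p`-multinorm inherited from `Y`. -/
def restrict (NY : PMultinorm p Y) (X : Submodule ℝ Y) [CompleteSpace X] : PMultinorm p X where
  norm n := (NY.norm n).comp (ampl p n X.subtype)
  norm_tmul n a x := by simp [ampl, NY.norm_tmul]
  pairing_le n φ ψ hφ hψ u := by
    obtain ⟨g, hg, hgn⟩ := _root_.exists_extension_norm_eq X ψ
    have h := NY.pairing_le n φ g hφ (hgn.trans_le hψ) (ampl p n X.subtype u)
    have e : tensorPairing φ g (ampl p n X.subtype u) = tensorPairing φ ψ u := by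
      induction u using TensorProduct.induction_on with
      | zero => simp
      | tmul a x => simp [ampl, hg]
      | add u v hu hv =>
        rw [map_add, map_add, map_add, hu, hv]
        · exact NY.pairing_le n φ g hφ (hgn.trans_le hψ) _
        · exact NY.pairing_le n φ g hφ (hgn.trans_le hψ) _
    rw [e] at h
    exact h
  norm_map_le n m T u := by
    have e : ampl p m X.subtype (TensorProduct.map T.toLinearMap LinearMap.id u) =
        TensorProduct.map T.toLinearMap LinearMap.id (ampl p n X.subtype u) := by
      simp only [ampl, ← LinearMap.comp_apply, ← TensorProduct.map_comp]
      simp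
    rw [Seminorm.comp_apply, Seminorm.comp_apply, e]
    exact NY.norm_map_le n m T _

/-- The maximal `p`-multinorm `max_p(E)` on a Banach space `E`, given by the projective tensor
products of `ℓ^p_n` and `E`. -/
def maxStructure (p : ℝ≥0∞) [Fact (1 ≤ p)] (E : Type*) [NormedAddCommGroup E] [NormedSpace ℝ E]
    [CompleteSpace E] : PMultinorm p E where
  norm n := projSeminorm (EllP p n) E
  norm_tmul _ a x := projNorm_tmul a x
  pairing_le _ φ ψ hφ hψ u := tensorPairing_le_projNorm φ ψ hφ hψ u
  norm_map_le _ _ T u := projNorm_map_le T u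

/-- The `p`-multinormed space `Z` is `c`-injective: for all `p`-multinormed spaces `X ⊆ Y`, every
`p`-multibounded `u : X → Z` has an extension `u' : Y → Z` with `‖u'‖_p ≤ c ‖u‖_p`. -/
def IsInjective {Z : Type w} [NormedAddCommGroup Z] [NormedSpace ℝ Z] [CompleteSpace Z]
    (NZ : PMultinorm p Z) (c : ℝ≥0) : Prop :=
  ∀ (Y : Type v) [NormedAddCommGroup Y] [NormedSpace ℝ Y] [CompleteSpace Y]
    (NY : PMultinorm p Y) (X : Submodule ℝ Y) [CompleteSpace X] (u : X →ₗ[ℝ] Z),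
    IsMultibounded (NY.restrict X) NZ u →
      ∃ u' : Y →ₗ[ℝ] Z, pNorm NY NZ u' ≤ c * pNorm (NY.restrict X) NZ u ∧ ∀ x : X, u' x = u x

end PMultinorm

end

/-! Write `q` for `p'`. A map `u : X → L^q` amounts to the functional `f ⊗ x ↦ ∫ f · u x` on `L^p ⊗
X`. Functionals on a projective tensor product are bounded bilinear forms, so multiboundedness into
`max_p(L^q)` controls this functional by `C = ‖u‖_p` along all contractions `ℓ^p_n → L^p`
(`abs_pairFunctional_map_le`).

The multinorm of `Y` passes to `L^p ⊗ Y` through all contractions `L^p → ℓ^p_n` (`extNorm`). A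
tensor built from finitely many indicators factors exactly through one `ℓ^p_m`, by averaging over
atoms and stepping back, so on such tensors the functional is at most `C * extNorm`. Hahn–Banach
extends it to `Φ` on `L^p ⊗ Y` with the same constant (`exists_functional_extension`); this is why
the injectivity constant is 1.

It remains to read a map `U : Y → L^q` off `Φ`. For `p = ∞` the functional `Φ(· ⊗ y)` need not come
from an `L^1` function, so only its countably additive part is kept: off sets of small measure `s ↦
Φ(1_s ⊗ y)` is absolutely continuous and has a Radon–Nikodym density (`exists_isDensity`). The same
argument serves every `p`. Densities are unique a.e., so `U` is linear and agrees with `u` on `X`.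
The bound `‖U‖_p ≤ C` holds for step approximations by duality between `ℓ^p_n ⊗ ℓ^q_m` and operators
`ℓ^p_n → ℓ^p_m` (`IsBoundedBy.projNorm_step_le`), then for truncated densities
(`IsBoundedBy.projNorm_truncation_le`), then in the limit (`projNorm_le_of_truncation`). -/

noncomputable section

open MeasureTheory Set Filter Topology

/-! ### Duality of the finite-dimensional spaces `ℓ^p_n` and `ℓ^q_n`. -/

section FiniteDuality

/-- Converse of Hölder's inequality on `ℓ^p_n`. -/
theorem EllP.norm_le_of_pairing_le {p q : ℝ≥0∞} [Fact (1 ≤ p)] [Fact (1 ≤ q)]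
    [hpq : p.HolderConjugate q] {n : ℕ} (c : EllP p n) {K : ℝ} (hK : 0 ≤ K)
    (h : ∀ b : EllP q n, ∑ i, c i * b i ≤ K * ‖b‖) : ‖c‖ ≤ K := by
  have hsign : ∀ r : ℝ, r * SignType.sign r = |r| := fun r => by
    rw [mul_comm]; exact sign_mul_self r
  have hsign1 : ∀ r : ℝ, ‖((SignType.sign r : SignType) : ℝ)‖ ≤ 1 := fun r => by
    rcases lt_trichotomy r 0 with hr | hr | hr <;> simp [hr]
  rcases eq_or_ne p ∞ with rfl | hp
  · obtain rfl : q = 1 := (ENNReal.HolderConjugate.eq_top_iff_eq_one ∞ q).1 rfl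
    rw [PiLp.norm_eq_ciSup]
    refine Real.iSup_le (fun i => ?_) hK
    have := h (WithLp.toLp 1 (Pi.single i ((SignType.sign (c i) : SignType) : ℝ)))
    rw [Finset.sum_eq_single i (fun j _ hj => by simp [hj]) (by simp)] at this
    simp only [Pi.single_eq_same, hsign] at this
    refine (Real.norm_eq_abs _).trans_le (this.trans ?_)
    refine mul_le_of_le_one_right hK ?_
    exact (PiLp.norm_single (p := 1) (fun _ : Fin n => ℝ) i _).trans_le (hsign1 _)
  rcases eq_or_ne q ∞ with rfl | hq
  · obtain rfl : p = 1 := (ENNReal.HolderConjugate.eq_top_iff_eq_one ∞ p).1 rfl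
    have := h (WithLp.toLp ∞ fun i => ((SignType.sign (c i) : SignType) : ℝ))
    simp only [hsign] at this
    rw [PiLp.norm_eq_of_L1]
    refine this.trans (mul_le_of_le_one_right hK ?_)
    rw [PiLp.norm_eq_ciSup]
    exact Real.iSup_le (fun i => hsign1 _) zero_le_one
  have hp0 : 0 < p.toReal := ENNReal.toReal_pos (ENNReal.HolderConjugate.ne_zero p q) hp
  have hq0 : 0 < q.toReal := ENNReal.toReal_pos (ENNReal.HolderConjugate.ne_zero q p) hq
  have hr : p.toReal.HolderConjugate q.toReal := by
    simpa using ENNReal.HolderTriple.toReal (p := p) (q := q) (r := 1) hp0 hq0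
  set P := p.toReal
  set Q := q.toReal
  set S : ℝ := ∑ i, |c i| ^ P with hS
  have hS0 : 0 ≤ S := by positivity
  have hc : ‖c‖ = S ^ (1 / P) := by
    rw [PiLp.norm_eq_sum hp0]; rfl
  -- The test vector is the equality case of Hölder's inequality: it pairs with `c` to `S = ‖c‖^P`
  -- and has `ℓ^q` norm at most `S^(1/Q)`.
  have hb := h (WithLp.toLp q fun i => (SignType.sign (c i) : ℝ) * |c i| ^ (P - 1))
  have h1 : ∑ i, c i * ((SignType.sign (c i) : ℝ) * |c i| ^ (P - 1)) = S := by
    refine Finset.sum_congr rfl fun i _ => ?_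
    rw [← mul_assoc, hsign]
    rcases (abs_nonneg (c i)).eq_or_lt with h0 | h0
    · rw [← h0, zero_mul, Real.zero_rpow hp0.ne']
    · rw [← Real.rpow_one_add' (abs_nonneg _) (by simpa using hp0.ne')]; congr 1; ring
  have h2 : ‖(WithLp.toLp q fun i => (SignType.sign (c i) : ℝ) * |c i| ^ (P - 1) : EllP q n)‖
      ≤ S ^ (1 / Q) := by
    rw [PiLp.norm_eq_sum hq0]
    refine Real.rpow_le_rpow (by positivity) ?_ (by positivity)
    refine Finset.sum_le_sum fun i _ => ?_
    have : ‖(SignType.sign (c i) : ℝ) * |c i| ^ (P - 1)‖ ≤ |c i| ^ (P - 1) := by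
      rw [norm_mul, Real.norm_of_nonneg (Real.rpow_nonneg (abs_nonneg _) _)]
      exact mul_le_of_le_one_left (by positivity) (hsign1 _)
    refine (Real.rpow_le_rpow (norm_nonneg _) this hq0.le).trans_eq ?_
    rw [← Real.rpow_mul (abs_nonneg _), hr.sub_one_mul_conj]
  simp only at hb
  rw [h1] at hb
  have h3 : S ≤ K * S ^ (1 / Q) := hb.trans (mul_le_mul_of_nonneg_left h2 hK)
  rw [hc]
  rcases hS0.eq_or_lt with h0 | h0
  · rw [← h0, Real.zero_rpow (by positivity)]; exact hK
  · have : S ^ (1 / P) * S ^ (1 / Q) = S := by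
      rw [← Real.rpow_add h0, hr.one_div_add_one_div, div_one, Real.rpow_one]
    exact le_of_mul_le_mul_right (this.trans_le h3) (by positivity)

end FiniteDuality

/-! ### Step functions: copies of `ℓ^q_m` in `L^q`. -/

variable {Ω : Type*} [MeasurableSpace Ω] {μ : Measure Ω}

theorem Lp.coeFn_finset_sum {E ι : Type*} [NormedAddCommGroup E] {q : ℝ≥0∞} (s : Finset ι)
    (f : ι → Lp E q μ) : (∑ i ∈ s, f i : Lp E q μ) =ᵐ[μ] fun x => ∑ i ∈ s, f i x := by
  classical
  induction s using Finset.induction_on with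
  | empty => exact Lp.coeFn_zero E q μ
  | insert i s hi ih =>
    rw [Finset.sum_insert hi]
    filter_upwards [Lp.coeFn_add (f i) (∑ i ∈ s, f i), ih] with x h1 h2
    rw [h1, Finset.sum_insert hi, Pi.add_apply, h2]

/-- A finite family of disjoint measurable sets with nonzero finite measure. -/
structure AtomFamily (μ : Measure Ω) (m : ℕ) where
  /-- the sets of the family -/
  set : Fin m → Set Ω
  measurableSet : ∀ i, MeasurableSet (set i)
  ne_top : ∀ i, μ (set i) ≠ ∞
  ne_zero : ∀ i, μ (set i) ≠ 0
  disjoint : Pairwise (Function.onFun Disjoint set)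

namespace AtomFamily

variable {m : ℕ} (A : AtomFamily μ m)

/-- The `L^q` norm of the indicator function of the `i`-th set. -/
def weight (q : ℝ≥0∞) (i : Fin m) : ℝ := μ.real (A.set i) ^ (1 / q.toReal)

theorem real_pos (i : Fin m) : 0 < μ.real (A.set i) :=
  ENNReal.toReal_pos (A.ne_zero i) (A.ne_top i)

theorem weight_pos (q : ℝ≥0∞) (i : Fin m) : 0 < A.weight q i :=
  Real.rpow_pos_of_pos (A.real_pos i) _

/-- The exponents add to 1. This includes the endpoint: `toReal` sends `∞` to `0`, so `1 / q.toReal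
= 0` and the weight is 1, the `L^∞` norm of the indicator of a non-null set. -/
theorem weight_mul_weight (p q : ℝ≥0∞) [hpq : p.HolderConjugate q] (i : Fin m) :
    A.weight p i * A.weight q i = μ.real (A.set i) := by
  rw [weight, weight, ← Real.rpow_add (A.real_pos i)]
  have h := congrArg ENNReal.toReal (ENNReal.HolderConjugate.inv_add_inv_eq_one p q)
  rw [ENNReal.toReal_add (by simp [ENNReal.HolderConjugate.ne_zero p q])
    (by simp [ENNReal.HolderConjugate.ne_zero q p]), ENNReal.toReal_inv, ENNReal.toReal_inv] at h
  rw [one_div, one_div, h, ENNReal.toReal_one, Real.rpow_one]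

/-- The indicator functions of the sets of the family. -/
def ind (q : ℝ≥0∞) (i : Fin m) : Lp ℝ q μ :=
  indicatorConstLp q (A.measurableSet i) (A.ne_top i) 1

/-- The embedding of `ℓ^q_m` into `L^q` as step functions. -/
def stepₗ (q : ℝ≥0∞) [Fact (1 ≤ q)] : EllP q m →ₗ[ℝ] Lp ℝ q μ where
  toFun a := ∑ i, (a i * (A.weight q i)⁻¹) • A.ind q i
  map_add' a b := by simp [add_mul, add_smul, Finset.sum_add_distrib]
  map_smul' c a := by simp [Finset.smul_sum, mul_assoc, mul_smul]

theorem sum_smul_ind_coeFn (q : ℝ≥0∞) [Fact (1 ≤ q)] (c : Fin m → ℝ) :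
    ((∑ i, c i • A.ind q i : Lp ℝ q μ) : Ω → ℝ) =ᵐ[μ]
      fun x => ∑ i, (A.set i).indicator (fun _ => c i) x := by
  have h1 : ∀ᵐ x ∂μ, ∀ i, (c i • A.ind q i : Lp ℝ q μ) x = (A.set i).indicator (fun _ => c i) x := by
    refine ae_all_iff.2 fun i => ?_
    filter_upwards [Lp.coeFn_smul (c i) (A.ind q i),
      indicatorConstLp_coeFn (p := q) (hs := A.measurableSet i) (hμs := A.ne_top i) (c := (1 : ℝ))]
      with x hx hx'
    rw [hx, Pi.smul_apply, ind, hx']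
    by_cases h : x ∈ A.set i <;> simp [h]
  filter_upwards [h1, Lp.coeFn_finset_sum Finset.univ (fun i => c i • A.ind q i)] with x hx hx'
  rw [hx']
  exact Finset.sum_congr rfl fun i _ => hx i

theorem sum_indicator_of_mem {M : Type*} [AddCommMonoid M] (c : Fin m → M) {x : Ω} {i : Fin m}
    (hx : x ∈ A.set i) : ∑ j, (A.set j).indicator (fun _ => c j) x = c i := by
  rw [Finset.sum_eq_single i, indicator_of_mem hx]
  · intro j _ hj
    exact indicator_of_notMem (fun hx' => (A.disjoint hj).le_bot ⟨hx', hx⟩) _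
  · simp

theorem sum_indicator_of_notMem {M : Type*} [AddCommMonoid M] (c : Fin m → M) {x : Ω}
    (hx : ∀ i, x ∉ A.set i) : ∑ j, (A.set j).indicator (fun _ => c j) x = 0 :=
  Finset.sum_eq_zero fun j _ => indicator_of_notMem (hx j) _

/-- By disjointness at most one summand is nonzero at each point, so the `q`-th power of the sum is
the sum of the `q`-th powers, and the weights cancel the measures. -/
theorem norm_stepₗ_le (q : ℝ≥0∞) [hq1 : Fact (1 ≤ q)] (a : EllP q m) : ‖A.stepₗ q a‖ ≤ ‖a‖ := by
  set c : Fin m → ℝ := fun i => a i * (A.weight q i)⁻¹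
  have hf : (A.stepₗ q a : Ω → ℝ) =ᵐ[μ] fun x => ∑ i, (A.set i).indicator (fun _ => c i) x :=
    A.sum_smul_ind_coeFn q c
  rcases eq_or_ne q ∞ with rfl | hq
  · rw [Lp.norm_def, eLpNorm_exponent_top]
    refine ENNReal.toReal_le_of_le_ofReal (norm_nonneg _) (eLpNormEssSup_le_of_ae_bound ?_)
    filter_upwards [hf] with x hx
    rw [hx]
    by_cases h : ∃ i, x ∈ A.set i
    · obtain ⟨i, hi⟩ := h
      rw [A.sum_indicator_of_mem c hi]
      simpa [c, weight] using PiLp.norm_apply_le a i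
    · rw [A.sum_indicator_of_notMem c (not_exists.1 h)]; simp
  · have hq0 : 0 < q.toReal :=
      ENNReal.toReal_pos (zero_lt_one.trans_le hq1.out).ne' hq
    rw [Lp.norm_def, eLpNorm_congr_ae hf,
      eLpNorm_eq_lintegral_rpow_enorm_toReal (zero_lt_one.trans_le hq1.out).ne' hq]
    have h1 : ∀ x, ‖∑ i, (A.set i).indicator (fun _ => c i) x‖ₑ ^ q.toReal =
        ∑ i, (A.set i).indicator (fun _ => ‖c i‖ₑ ^ q.toReal) x := by
      intro x
      by_cases h : ∃ i, x ∈ A.set i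
      · obtain ⟨i, hi⟩ := h
        rw [A.sum_indicator_of_mem _ hi, A.sum_indicator_of_mem _ hi]
      · rw [A.sum_indicator_of_notMem _ (not_exists.1 h),
          A.sum_indicator_of_notMem _ (not_exists.1 h)]
        simp [hq0]
    simp only [h1]
    rw [lintegral_finsetSum _ fun i _ => measurable_const.indicator (A.measurableSet i)]
    simp only [lintegral_indicator_const (A.measurableSet _)]
    have h2 : ∀ i, ‖c i‖ₑ ^ q.toReal * μ (A.set i) = ENNReal.ofReal (‖a i‖ ^ q.toReal) := by
      intro i
      have h3 : A.weight q i ^ q.toReal = μ.real (A.set i) := by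
        rw [weight, ← Real.rpow_mul (A.real_pos i).le, one_div_mul_cancel hq0.ne', Real.rpow_one]
      rw [← ENNReal.ofReal_toReal (A.ne_top i), ← ofReal_norm,
        ENNReal.ofReal_rpow_of_nonneg (norm_nonneg _) hq0.le, ← ENNReal.ofReal_mul (by positivity)]
      congr 1
      change _ * μ.real (A.set i) = _
      have hw := A.weight_pos q i
      rw [← h3, ← Real.mul_rpow (norm_nonneg _) hw.le, norm_mul, norm_inv,
        Real.norm_of_nonneg hw.le, inv_mul_cancel_right₀ hw.ne']
    simp only [h2]
    rw [← ENNReal.ofReal_sum_of_nonneg fun i _ => by positivity,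
      ENNReal.ofReal_rpow_of_nonneg (by positivity) (by positivity),
      ENNReal.toReal_ofReal (by positivity), PiLp.norm_eq_sum hq0]

/-- The contractive embedding of `ℓ^q_m` into `L^q` as step functions. -/
def step (q : ℝ≥0∞) [Fact (1 ≤ q)] : EllP q m →L[ℝ] Lp ℝ q μ :=
  (A.stepₗ q).mkContinuous 1 fun a => by simpa using A.norm_stepₗ_le q a

theorem step_apply (q : ℝ≥0∞) [Fact (1 ≤ q)] (a : EllP q m) :
    A.step q a = ∑ i, (a i * (A.weight q i)⁻¹) • A.ind q i := rfl

theorem norm_step_le (q : ℝ≥0∞) [Fact (1 ≤ q)] : ‖A.step (μ := μ) q‖ ≤ 1 :=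
  LinearMap.mkContinuous_norm_le _ zero_le_one _

end AtomFamily

/-! ### The pairing of `L^p` and `L^q`. -/

section Pairing

/-- The duality pairing of `L^p` and `L^q`. -/
def lpPair (μ : Measure Ω) (p q : ℝ≥0∞) [Fact (1 ≤ p)] [Fact (1 ≤ q)] [p.HolderConjugate q] :
    Lp ℝ p μ →L[ℝ] Lp ℝ q μ →L[ℝ] ℝ :=
  (ContinuousLinearMap.mul ℝ ℝ).lpPairing μ p q

variable {p q : ℝ≥0∞} [Fact (1 ≤ p)] [Fact (1 ≤ q)] [p.HolderConjugate q]

theorem lpPair_eq_integral (f : Lp ℝ p μ) (g : Lp ℝ q μ) :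
    lpPair μ p q f g = ∫ x, f x * g x ∂μ :=
  (ContinuousLinearMap.mul ℝ ℝ).lpPairing_eq_integral f g

theorem abs_lpPair_le (f : Lp ℝ p μ) (g : Lp ℝ q μ) : |lpPair μ p q f g| ≤ ‖f‖ * ‖g‖ := by
  have h1 := L1.norm_integral_le ((ContinuousLinearMap.mul ℝ ℝ).holder 1 f g)
  rw [L1.integral_eq_integral,
    integral_congr_ae ((ContinuousLinearMap.mul ℝ ℝ).coeFn_holder f g)] at h1
  have h2 := (ContinuousLinearMap.mul ℝ ℝ).norm_holder_apply_apply_le (r := 1) f g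
  rw [ContinuousLinearMap.opNorm_mul, one_mul] at h2
  rw [lpPair_eq_integral]
  exact h1.trans h2

theorem lpPair_indicator {s : Set Ω} (hs : MeasurableSet s) (hμ : μ s ≠ ∞) (g : Lp ℝ q μ) :
    lpPair μ p q (indicatorConstLp p hs hμ 1) g = ∫ x in s, g x ∂μ := by
  rw [lpPair_eq_integral, ← integral_indicator hs]
  refine integral_congr_ae ?_
  filter_upwards [indicatorConstLp_coeFn (p := p) (hs := hs) (hμs := hμ) (c := (1 : ℝ))] with x hx
  rw [hx]
  by_cases h : x ∈ s <;> simp [h]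

end Pairing

end

/-! ### Averaging over atom families, and the construction of such families. -/

noncomputable section

open MeasureTheory Set Filter Topology

variable {Ω : Type*} [MeasurableSpace Ω] {μ : Measure Ω}

namespace AtomFamily

variable {m : ℕ} (A : AtomFamily μ m)
variable {p q : ℝ≥0∞} [Fact (1 ≤ p)] [Fact (1 ≤ q)] [p.HolderConjugate q]

theorem lpPair_step (a : EllP p m) (g : Lp ℝ q μ) :
    lpPair μ p q (A.step p a) g = ∑ i, a i * ((A.weight p i)⁻¹ * ∫ x in A.set i, g x ∂μ) := by
  rw [step_apply, map_sum, _root_.sum_apply]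
  refine Finset.sum_congr rfl fun i _ => ?_
  rw [map_smul, _root_.smul_apply, ind, lpPair_indicator, smul_eq_mul, mul_assoc]

/-- The weighted averages of an `L^q` function over the sets of the family; `A.avgₗ p q` is a left
inverse of `A.step q`. -/
def avgₗ (p q : ℝ≥0∞) [Fact (1 ≤ p)] [Fact (1 ≤ q)] [p.HolderConjugate q] :
    Lp ℝ q μ →ₗ[ℝ] EllP q m where
  toFun g := WithLp.toLp q fun i => (A.weight p i)⁻¹ * lpPair μ p q (A.ind p i) g
  map_add' f g := by ext i; simp [mul_add]
  map_smul' c f := by ext i; simp; ring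

theorem avgₗ_apply (g : Lp ℝ q μ) (i : Fin m) :
    A.avgₗ p q g i = (A.weight p i)⁻¹ * ∫ x in A.set i, g x ∂μ := by
  simp only [avgₗ, LinearMap.coe_mk, AddHom.coe_mk, ind]
  rw [lpPair_indicator]

/-- Averaging is the adjoint of the contraction `A.step p` under the pairing, so the converse of
Hölder's inequality applies. -/
theorem norm_avgₗ_le (g : Lp ℝ q μ) : ‖A.avgₗ p q g‖ ≤ ‖g‖ := by
  refine EllP.norm_le_of_pairing_le (q := p) _ (norm_nonneg _) fun b => ?_
  have h := A.lpPair_step b g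
  simp only [avgₗ_apply, mul_comm _ (b _)]
  rw [← h, mul_comm]
  refine (le_abs_self _).trans ((abs_lpPair_le _ _).trans ?_)
  exact mul_le_mul_of_nonneg_right (A.norm_stepₗ_le p b) (norm_nonneg _)

/-- The weighted averages of an `L^q` function, as a contraction onto `ℓ^q_m`. -/
def avg (p q : ℝ≥0∞) [Fact (1 ≤ p)] [Fact (1 ≤ q)] [p.HolderConjugate q] :
    Lp ℝ q μ →L[ℝ] EllP q m :=
  (A.avgₗ p q).mkContinuous 1 fun g => by simpa using A.norm_avgₗ_le g

theorem avg_apply (g : Lp ℝ q μ) (i : Fin m) :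
    A.avg p q g i = (A.weight p i)⁻¹ * ∫ x in A.set i, g x ∂μ := A.avgₗ_apply g i

theorem norm_avg_le : ‖A.avg (μ := μ) p q‖ ≤ 1 := LinearMap.mkContinuous_norm_le _ zero_le_one _

/-- The two weights multiply to the measure of the set, so averaging and stepping back is a
conditional expectation: each set carries the mean of `g`. -/
theorem step_avg (g : Lp ℝ q μ) : A.step q (A.avg p q g) =
    ∑ i, ((μ.real (A.set i))⁻¹ * ∫ x in A.set i, g x ∂μ) • A.ind q i := by
  rw [step_apply]
  refine Finset.sum_congr rfl fun i _ => ?_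
  rw [avg_apply, ← A.weight_mul_weight p q, mul_inv]
  congr 1
  ring

theorem step_avg_indicator {s : Set Ω} (hs : MeasurableSet s) (hμ : μ s ≠ ∞)
    (hA : ∀ i, A.set i ⊆ s ∨ Disjoint (A.set i) s) (hc : ∀ᵐ x ∂μ, x ∈ s → ∃ i, x ∈ A.set i) :
    A.step q (A.avg p q (indicatorConstLp q hs hμ 1)) = indicatorConstLp q hs hμ 1 := by
  rw [step_avg]
  refine Lp.ext ?_
  filter_upwards [A.sum_smul_ind_coeFn q
    (fun i => (μ.real (A.set i))⁻¹ * ∫ x in A.set i, indicatorConstLp q hs hμ 1 x ∂μ),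
    indicatorConstLp_coeFn (p := q) (hs := hs) (hμs := hμ) (c := (1 : ℝ)), hc] with x hx hx' hxc
  rw [hx, hx']
  have hint : ∀ i, ∫ x in A.set i, indicatorConstLp q hs hμ 1 x ∂μ = μ.real (s ∩ A.set i) := by
    intro i
    rw [setIntegral_indicatorConstLp (A.measurableSet i)]; simp
  by_cases h : ∃ i, x ∈ A.set i
  · obtain ⟨i, hi⟩ := h
    rw [A.sum_indicator_of_mem _ hi, hint]
    rcases hA i with h | h
    · rw [indicator_of_mem (h hi), inter_eq_right.2 h, inv_mul_cancel₀ (A.real_pos i).ne']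
    · rw [indicator_of_notMem (fun hx => h.le_bot ⟨hi, hx⟩), h.symm.inter_eq]; simp
  · rw [A.sum_indicator_of_notMem _ (not_exists.1 h), indicator_of_notMem fun hx => h (hxc hx)]

end AtomFamily

/-- The fibres over `D` of a function with finitely many values form an atom family, up to a null
set. -/
theorem exists_atomFamily {ι : Type*} {D : Set Ω} (hD : MeasurableSet D) (hμD : μ D ≠ ∞)
    (s : Ω → ι) (hs : ∀ i, MeasurableSet (s ⁻¹' {i})) (hfin : (s '' D).Finite) :
    ∃ (m : ℕ) (A : AtomFamily μ m) (c : Fin m → ι), (∀ i, A.set i = D ∩ s ⁻¹' {c i}) ∧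
      ∀ᵐ x ∂μ, x ∈ D → ∃ i, x ∈ A.set i := by
  classical
  -- Members of an atom family have nonzero measure, so null fibres are discarded; the rest cover
  -- `D` only almost everywhere.
  have hT : {i | μ (D ∩ s ⁻¹' {i}) ≠ 0}.Finite := by
    refine hfin.subset fun i hi => ?_
    obtain ⟨x, hx, rfl⟩ := nonempty_of_measure_ne_zero hi
    exact ⟨x, hx, rfl⟩
  have := hT.to_subtype
  have := Fintype.ofFinite {i | μ (D ∩ s ⁻¹' {i}) ≠ 0}
  set e := (Fintype.equivFin {i | μ (D ∩ s ⁻¹' {i}) ≠ 0}).symm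
  refine ⟨_, ⟨fun i => D ∩ s ⁻¹' {(e i : ι)}, fun i => hD.inter (hs _),
    fun i => ne_top_of_le_ne_top hμD (measure_mono inter_subset_left), fun i => (e i).2, ?_⟩,
    fun i => e i, fun _ => rfl, ?_⟩
  · intro i j hij
    refine Set.disjoint_left.2 fun x hx hx' => hij ?_
    exact e.injective (Subtype.ext (hx.2.symm.trans hx'.2))
  · have h : ∀ i ∈ s '' D, ∀ᵐ x ∂μ, μ (D ∩ s ⁻¹' {i}) = 0 → x ∉ D ∩ s ⁻¹' {i} := by
      intro i _
      by_cases h0 : μ (D ∩ s ⁻¹' {i}) = 0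
      · filter_upwards [measure_eq_zero_iff_ae_notMem.1 h0] with x hx _ using hx
      · simp [h0]
    filter_upwards [(ae_ball_iff hfin.countable).2 h] with x hx hxD
    have h1 : μ (D ∩ s ⁻¹' {s x}) ≠ 0 := fun h0 =>
      hx (s x) (mem_image_of_mem s hxD) h0 ⟨hxD, rfl⟩
    exact ⟨e.symm ⟨s x, h1⟩, hxD, by simp⟩

/-- The family consists of the non-null atoms inside `⋃ k, B k` of the finite algebra generated by
the `B k`, that is, the fibres of the membership pattern `k ↦ x ∈ B k`. -/
theorem exists_atomFamily_of_sets {κ : Type*} [Finite κ] (B : κ → Set Ω)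
    (hB : ∀ k, MeasurableSet (B k)) (hμB : ∀ k, μ (B k) ≠ ∞) :
    ∃ (m : ℕ) (A : AtomFamily μ m), (∀ k i, A.set i ⊆ B k ∨ Disjoint (A.set i) (B k)) ∧
      ∀ᵐ x ∂μ, ∀ k, x ∈ B k → ∃ i, x ∈ A.set i := by
  have hs : ∀ c : κ → Prop, MeasurableSet ((fun x k => x ∈ B k) ⁻¹' {c}) := by
    intro c
    have : (fun x k => x ∈ B k) ⁻¹' {c} = ⋂ k, {x | x ∈ B k ↔ c k} := by
      ext x; simp [funext_iff]
    rw [this]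
    refine MeasurableSet.iInter fun k => ?_
    by_cases h : c k
    · simpa [h] using hB k
    · simp only [h, iff_false]
      exact (hB k).compl
  obtain ⟨m, A, c, hA, hc⟩ := exists_atomFamily (μ := μ) (MeasurableSet.iUnion hB)
    (by simpa using (measure_biUnion_lt_top (μ := μ) (Set.finite_univ (α := κ)) (f := B)
      fun k _ => (hμB k).lt_top).ne)
    (fun x k => x ∈ B k) hs (Set.toFinite _)
  refine ⟨m, A, fun k i => ?_, ?_⟩
  · by_cases h : c i k
    · left
      intro x hx
      rw [hA i] at hx
      have h2 : (fun k => x ∈ B k) = c i := hx.2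
      exact (congrFun h2 k).mpr h
    · right
      refine Set.disjoint_left.2 fun x hx hx' => h ?_
      rw [hA i] at hx
      have h2 : (fun k => x ∈ B k) = c i := hx.2
      exact (congrFun h2 k).mp hx'
  · filter_upwards [hc] with x hx k hk using hx (mem_iUnion.2 ⟨k, hk⟩)

/-- Finitely many bounded functions are uniformly close to their averages over the sets of some
atom family. -/
theorem exists_atomFamily_of_bounded {κ : Type*} [Finite κ] (f : κ → Ω → ℝ)
    (hf : ∀ k, Measurable (f k)) {D : Set Ω} (hD : MeasurableSet D) (hμD : μ D ≠ ∞) {M : ℝ}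
    (hM : ∀ k, ∀ x ∈ D, |f k x| ≤ M) {ε : ℝ} (hε : 0 < ε) :
    ∃ (m : ℕ) (A : AtomFamily μ m), (∀ i, A.set i ⊆ D) ∧
      (∀ᵐ x ∂μ, x ∈ D → ∃ i, x ∈ A.set i) ∧
      ∀ k i, ∀ x ∈ A.set i, |f k x - (μ.real (A.set i))⁻¹ * ∫ y in A.set i, f k y ∂μ| ≤ ε := by
  -- The atoms are the fibres of `x ↦ (⌊f k x / ε⌋)_k`, which has finitely many values on `D`. On a
  -- fibre each `f k`, and hence its mean, stays in an interval of length `ε`.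
  have hs : ∀ c : κ → ℤ, MeasurableSet ((fun x k => ⌊f k x / ε⌋) ⁻¹' {c}) := by
    intro c
    have : (fun x k => ⌊f k x / ε⌋) ⁻¹' {c} = ⋂ k, {x | ⌊f k x / ε⌋ = c k} := by
      ext x; simp [funext_iff]
    rw [this]
    exact MeasurableSet.iInter fun k =>
      measurableSet_eq_fun (((hf k).div_const ε).floor) measurable_const
  obtain ⟨m, A, c, hA, hc⟩ := exists_atomFamily (μ := μ) hD hμD (fun x k => ⌊f k x / ε⌋) hs (by
    refine (Set.Finite.pi' (t := fun _ : κ => Set.Icc ⌊-M / ε⌋ ⌊M / ε⌋)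
      fun _ => Set.finite_Icc _ _).subset ?_
    rintro _ ⟨x, hx, rfl⟩ k
    have := abs_le.1 (hM k x hx)
    exact ⟨Int.floor_le_floor (by gcongr; exact this.1), Int.floor_le_floor (by gcongr; exact this.2)⟩)
  have hAD : ∀ i, A.set i ⊆ D := fun i => by rw [hA i]; exact inter_subset_left
  refine ⟨m, A, hAD, hc, fun k i x hx => ?_⟩
  have hb : ∀ y ∈ A.set i, c i k * ε ≤ f k y ∧ f k y ≤ c i k * ε + ε := by
    intro y hy
    rw [hA i] at hy
    have h2 : ⌊f k y / ε⌋ = c i k := congrFun hy.2 k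
    rw [← h2]
    have h3 := Int.floor_le (f k y / ε)
    have h4 := (Int.lt_floor_add_one (f k y / ε)).le
    rw [le_div_iff₀ hε] at h3
    rw [div_le_iff₀ hε] at h4
    exact ⟨h3, by linarith⟩
  have hpos := A.real_pos i
  have hint : IntegrableOn (f k) (A.set i) μ := by
    refine Measure.integrableOn_of_bounded (M := M) (A.ne_top i) (hf k).aestronglyMeasurable ?_
    filter_upwards [ae_restrict_mem (A.measurableSet i)] with y hy using hM k y (hAD i hy)
  have hl : c i k * ε ≤ (μ.real (A.set i))⁻¹ * ∫ y in A.set i, f k y ∂μ := by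
    rw [le_inv_mul_iff₀ hpos]
    have := setIntegral_mono_on (μ := μ) (s := A.set i) (f := fun _ => c i k * ε) (g := f k)
      (integrableOn_const (A.ne_top i)) hint (A.measurableSet i) fun y hy => (hb y hy).1
    simpa using this
  have hu : (μ.real (A.set i))⁻¹ * ∫ y in A.set i, f k y ∂μ ≤ c i k * ε + ε := by
    rw [inv_mul_le_iff₀ hpos]
    have := setIntegral_mono_on (μ := μ) (s := A.set i) (g := fun _ => c i k * ε + ε) (f := f k)
      hint (integrableOn_const (A.ne_top i)) (A.measurableSet i) fun y hy => (hb y hy).2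
    simpa using this
  have := hb x hx
  rw [abs_le]
  constructor <;> linarith [this.1, this.2]

end

/-! ### Hahn–Banach extension of the functional to `L^p ⊗ Y`. -/

noncomputable section

open MeasureTheory Set Filter Topology

/-- Hahn–Banach for a functional given on the source of a linear map. -/
theorem exists_linear_extension_of_le_sublinear {E V : Type*} [AddCommGroup E] [Module ℝ E]
    [AddCommGroup V] [Module ℝ V] (j : E →ₗ[ℝ] V) (f : E →ₗ[ℝ] ℝ) (N : V → ℝ)
    (N_hom : ∀ c : ℝ, 0 < c → ∀ x, N (c • x) = c * N x)
    (N_add : ∀ x y, N (x + y) ≤ N x + N y) (hf : ∀ e, f e ≤ N (j e)) :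
    ∃ g : V →ₗ[ℝ] ℝ, (∀ e, g (j e) = f e) ∧ ∀ v, g v ≤ N v := by
  have hN0 : N 0 = 0 := by
    have := N_hom 2 two_pos 0
    rw [smul_zero] at this
    linarith
  -- Applied to `e` and `-e`, the bound makes `f` vanish on the kernel of `j`, so injectivity of `j`
  -- is not needed.
  have hker : LinearMap.ker j ≤ LinearMap.ker f := by
    intro e he
    rw [LinearMap.mem_ker] at he ⊢
    have h1 := hf e
    have h2 := hf (-e)
    rw [map_neg, map_neg, he, neg_zero, hN0] at h2
    rw [he, hN0] at h1
    linarith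
  set F : LinearMap.range j →ₗ[ℝ] ℝ :=
    (LinearMap.ker j).liftQ f hker ∘ₗ j.quotKerEquivRange.symm.toLinearMap with hF
  have hFj : ∀ e, F ⟨j e, LinearMap.mem_range_self j e⟩ = f e := by
    intro e
    have : j.quotKerEquivRange.symm ⟨j e, LinearMap.mem_range_self j e⟩ =
        (LinearMap.ker j).mkQ e := LinearMap.quotKerEquivRange_symm_apply_image j e _
    rw [hF, LinearMap.comp_apply, LinearEquiv.coe_coe, this]
    simp
  obtain ⟨g, hg, hgN⟩ := exists_extension_of_le_sublinear ⟨LinearMap.range j, F⟩ N N_hom N_add (by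
    rintro ⟨_, e, rfl⟩
    exact (hFj e).trans_le (hf e))
  exact ⟨g, fun e => (hg ⟨j e, LinearMap.mem_range_self j e⟩).trans (hFj e), hgN⟩

theorem projNorm_nonneg {E F : Type*} [NormedAddCommGroup E] [NormedSpace ℝ E]
    [NormedAddCommGroup F] [NormedSpace ℝ F] (u : E ⊗[ℝ] F) : 0 ≤ projNorm u :=
  le_csInf (projCosts_nonempty _) fun _ h => projCosts_nonneg h

theorem abs_le_projNorm {E F : Type*} [NormedAddCommGroup E] [NormedSpace ℝ E]
    [NormedAddCommGroup F] [NormedSpace ℝ F] (f : E ⊗[ℝ] F →ₗ[ℝ] ℝ)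
    (hf : ∀ a x, |f (a ⊗ₜ x)| ≤ ‖a‖ * ‖x‖) (u : E ⊗[ℝ] F) : |f u| ≤ projNorm u := by
  refine le_csInf (projCosts_nonempty u) ?_
  rintro _ ⟨k, a, x, rfl, rfl⟩
  rw [map_sum]
  exact (Finset.abs_sum_le_sum_abs _ _).trans (Finset.sum_le_sum fun i _ => hf _ _)

/-- Every tensor is normed by a functional bounded by the projective norm. -/
theorem exists_functional_eq_projNorm {E F : Type*} [NormedAddCommGroup E] [NormedSpace ℝ E]
    [NormedAddCommGroup F] [NormedSpace ℝ F] (u : E ⊗[ℝ] F) :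
    ∃ f : E ⊗[ℝ] F →ₗ[ℝ] ℝ, f u = projNorm u ∧ ∀ v, f v ≤ projNorm v := by
  have hneg : ∀ c : ℝ, c * projNorm u ≤ projNorm (c • u) := by
    intro c
    rcases le_total 0 c with h | h
    · exact (((projSeminorm E F).smul' c u).trans (by rw [Real.norm_of_nonneg h]; rfl)).ge
    · exact (mul_nonpos_of_nonpos_of_nonneg h (projNorm_nonneg u)).trans (projNorm_nonneg _)
  obtain ⟨g, hg, hgN⟩ := exists_linear_extension_of_le_sublinear
    (LinearMap.toSpanSingleton ℝ (E ⊗[ℝ] F) u) (LinearMap.toSpanSingleton ℝ ℝ (projNorm u))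
    projNorm (fun c hc x => by
      have := (projSeminorm E F).smul' c x
      rw [Real.norm_of_nonneg hc.le] at this
      exact this)
    projNorm_add_le (fun c => hneg c)
  exact ⟨g, by simpa using hg 1, hgN⟩

namespace PMultinorm

variable {p : ℝ≥0∞} [Fact (1 ≤ p)] {Y : Type*} [NormedAddCommGroup Y] [NormedSpace ℝ Y]
  [CompleteSpace Y]

section ExtNorm

variable {Z : Type*} [NormedAddCommGroup Z] [NormedSpace ℝ Z] (N : PMultinorm p Y)

/-- The extension of a `p`-multinorm on `Y` to `Z ⊗ Y`, by means of all contractions from `Z` to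
the spaces `ℓ^p_n`. -/
def extNorm (v : Z ⊗[ℝ] Y) : ℝ :=
  sSup {r | ∃ (n : ℕ) (L : Z →L[ℝ] EllP p n), ‖L‖ ≤ 1 ∧
    r = N.norm n (TensorProduct.map L.toLinearMap LinearMap.id v)}

theorem norm_map_le_extNorm (v : Z ⊗[ℝ] Y) {n : ℕ} (L : Z →L[ℝ] EllP p n) (hL : ‖L‖ ≤ 1) :
    N.norm n (TensorProduct.map L.toLinearMap LinearMap.id v) ≤ N.extNorm v := by
  -- Any representation of `v` bounds the set; without this, `sSup` would take its default value
  -- `0`.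
  refine le_csSup ?_ ⟨n, L, hL, rfl⟩
  obtain ⟨k, a, x, rfl⟩ := TensorProduct.exists_sum_tmul_eq v
  refine ⟨∑ i, ‖a i‖ * ‖x i‖, ?_⟩
  rintro _ ⟨n, L, hL, rfl⟩
  rw [map_sum]
  refine (Finset.le_sum_of_subadditive (N.norm n) (map_zero _).le (map_add_le_add _) _ _).trans (Finset.sum_le_sum fun i _ => ?_)
  rw [TensorProduct.map_tmul, N.norm_tmul]
  exact mul_le_mul_of_nonneg_right ((L.le_of_opNorm_le hL _).trans_eq (one_mul _)) (norm_nonneg _)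

theorem extNorm_le {v : Z ⊗[ℝ] Y} {K : ℝ} (h : ∀ (n : ℕ) (L : Z →L[ℝ] EllP p n), ‖L‖ ≤ 1 →
    N.norm n (TensorProduct.map L.toLinearMap LinearMap.id v) ≤ K) : N.extNorm v ≤ K := by
  refine csSup_le ⟨_, 0, 0, by simp, rfl⟩ ?_
  rintro _ ⟨n, L, hL, rfl⟩
  exact h n L hL

theorem extNorm_add_le (v w : Z ⊗[ℝ] Y) : N.extNorm (v + w) ≤ N.extNorm v + N.extNorm w :=
  N.extNorm_le fun n L hL => by
    rw [map_add]
    exact (map_add_le_add _ _ _).trans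
      (add_le_add (N.norm_map_le_extNorm v L hL) (N.norm_map_le_extNorm w L hL))

theorem extNorm_smul_le {c : ℝ} (hc : 0 < c) (v : Z ⊗[ℝ] Y) :
    N.extNorm (c • v) ≤ c * N.extNorm v :=
  N.extNorm_le fun n L hL => by
    rw [map_smul, map_smul_eq_mul, Real.norm_of_nonneg hc.le]
    exact mul_le_mul_of_nonneg_left (N.norm_map_le_extNorm v L hL) hc.le

theorem extNorm_smul {c : ℝ} (hc : 0 < c) (v : Z ⊗[ℝ] Y) :
    N.extNorm (c • v) = c * N.extNorm v := by
  refine le_antisymm (N.extNorm_smul_le hc v) ?_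
  have := N.extNorm_smul_le (inv_pos.2 hc) (c • v)
  rwa [inv_smul_smul₀ hc.ne', le_inv_mul_iff₀ hc] at this

/-- Each `L ∘ S` is a contraction between `ℓ^p` spaces, so axiom (3) applies. This turns an
`extNorm` bound back into one by the given multinorm. -/
theorem extNorm_map_le {n : ℕ} (S : EllP p n →L[ℝ] Z) (hS : ‖S‖ ≤ 1) (t : EllP p n ⊗[ℝ] Y) :
    N.extNorm (TensorProduct.map S.toLinearMap LinearMap.id t) ≤ N.norm n t := by
  refine N.extNorm_le fun m L hL => ?_
  have h := N.norm_map_le n m (L ∘L S) t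
  have e : TensorProduct.map (L ∘L S).toLinearMap (LinearMap.id : Y →ₗ[ℝ] Y) t =
      TensorProduct.map L.toLinearMap LinearMap.id
        (TensorProduct.map S.toLinearMap LinearMap.id t) := by
    rw [← LinearMap.comp_apply, ← TensorProduct.map_comp]; rfl
  rw [e] at h
  refine h.trans (mul_le_of_le_one_left (apply_nonneg _ _) ?_)
  exact (L.opNorm_comp_le S).trans (mul_le_one₀ hL (norm_nonneg _) hS)

end ExtNorm

variable {Ω : Type*} [MeasurableSpace Ω] {μ : Measure Ω}
  {q : ℝ≥0∞} [Fact (1 ≤ q)] [p.HolderConjugate q]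

/-- The functional on `L^p ⊗ X` associated with a map from `X` to `L^q`. -/
def pairFunctional {X : Type*} [AddCommGroup X] [Module ℝ X] (u : X →ₗ[ℝ] Lp ℝ q μ) :
    Lp ℝ p μ ⊗[ℝ] X →ₗ[ℝ] ℝ :=
  TensorProduct.lift ((lpPair μ p q).toLinearMap₁₂.compl₂ u)

@[simp]
theorem pairFunctional_tmul {X : Type*} [AddCommGroup X] [Module ℝ X] (u : X →ₗ[ℝ] Lp ℝ q μ)
    (f : Lp ℝ p μ) (x : X) : pairFunctional (p := p) u (f ⊗ₜ x) = lpPair μ p q f (u x) := rfl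

/-- By Hölder the bilinear form `(a, g) ↦ ⟨S a, g⟩` is contractive, hence dominated by the
projective norm. This is where the maximality of the multinorm on the target enters. -/
theorem abs_pairFunctional_map_le {X : Type*} [AddCommGroup X] [Module ℝ X]
    (u : X →ₗ[ℝ] Lp ℝ q μ) {n : ℕ} (S : EllP p n →L[ℝ] Lp ℝ p μ) (hS : ‖S‖ ≤ 1)
    (t : EllP p n ⊗[ℝ] X) :
    |pairFunctional u (TensorProduct.map S.toLinearMap LinearMap.id t)| ≤
      projNorm (ampl p n u t) := by
  have e : pairFunctional u (TensorProduct.map S.toLinearMap LinearMap.id t) =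
      pairFunctional LinearMap.id (TensorProduct.map S.toLinearMap LinearMap.id (ampl p n u t)) := by
    induction t using TensorProduct.induction_on with
    | zero => simp
    | tmul a x => simp [ampl]
    | add v w hv hw => simp only [map_add, hv, hw]
  rw [e]
  let f : EllP p n ⊗[ℝ] Lp ℝ q μ →ₗ[ℝ] ℝ :=
    pairFunctional LinearMap.id ∘ₗ TensorProduct.map S.toLinearMap LinearMap.id
  have hf : ∀ (a : EllP p n) (g : Lp ℝ q μ), |f (a ⊗ₜ g)| ≤ ‖a‖ * ‖g‖ := by
    intro a g
    have h1 : ‖S a‖ ≤ ‖a‖ := (S.le_of_opNorm_le hS a).trans_eq (one_mul _)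
    exact (abs_lpPair_le (S a) g).trans (mul_le_mul_of_nonneg_right h1 (norm_nonneg _))
  exact abs_le_projNorm f hf _

/-- A multibounded map from a subspace `X` of `Y` to `L^q` is represented on `L^p ⊗ X` by a
functional that extends to `L^p ⊗ Y` with the same bound. -/
theorem exists_functional_extension (N : PMultinorm p Y) (X : Submodule ℝ Y) [CompleteSpace X]
    (u : X →ₗ[ℝ] Lp ℝ q μ) {C : ℝ} (hC : 0 ≤ C)
    (hu : ∀ n t, projNorm (ampl p n u t) ≤ C * (N.restrict X).norm n t) :
    ∃ Φ : Lp ℝ p μ ⊗[ℝ] Y →ₗ[ℝ] ℝ,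
      (∀ (s : Set Ω) (hs : MeasurableSet s) (hμ : μ s ≠ ∞) (x : X),
        Φ (indicatorConstLp p hs hμ 1 ⊗ₜ (x : Y)) = ∫ ω in s, u x ω ∂μ) ∧
      ∀ (n : ℕ) (S : EllP p n →L[ℝ] Lp ℝ p μ), ‖S‖ ≤ 1 → ∀ t : EllP p n ⊗[ℝ] Y,
        |Φ (TensorProduct.map S.toLinearMap LinearMap.id t)| ≤ C * N.norm n t := by
  -- The functional is prescribed only on indicators tensored with `X`. They determine the densities
  -- used later, even for `p = ∞`, where their span need not be dense.
  set ind : {s : Set Ω // MeasurableSet s ∧ μ s ≠ ∞} → Lp ℝ p μ :=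
    fun s => indicatorConstLp p s.2.1 s.2.2 1 with hind
  set jX : ({s : Set Ω // MeasurableSet s ∧ μ s ≠ ∞} →₀ X) →ₗ[ℝ] Lp ℝ p μ ⊗[ℝ] X :=
    Finsupp.lsum ℝ fun s => TensorProduct.mk ℝ (Lp ℝ p μ) X (ind s) with hjX
  have hbound : ∀ e, pairFunctional u (jX e) ≤
      C * N.extNorm (TensorProduct.map LinearMap.id X.subtype (jX e)) := by
    intro e
    obtain ⟨m, A, hA, hc⟩ := exists_atomFamily_of_sets (μ := μ)
      (fun s : e.support => (s : {s : Set Ω // MeasurableSet s ∧ μ s ≠ ∞}).1)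
      (fun s => s.1.2.1) (fun s => s.1.2.2)
    -- The atoms are adapted to the sets occurring in `e`, so the tensor is recovered exactly after
    -- passing through `ℓ^p_m`; there `hu` applies, and `A.avg q p` is one of the contractions in
    -- the supremum `extNorm`.
    have hfix : TensorProduct.map (A.step p).toLinearMap LinearMap.id
        (TensorProduct.map (A.avg q p).toLinearMap LinearMap.id (jX e)) = jX e := by
      rw [hjX, Finsupp.lsum_apply, Finsupp.sum, map_sum, map_sum]
      refine Finset.sum_congr rfl fun s hs => ?_
      simp only [TensorProduct.mk_apply, TensorProduct.map_tmul, LinearMap.id_apply,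
        ContinuousLinearMap.coe_coe]
      congr 1
      exact A.step_avg_indicator s.2.1 s.2.2 (hA ⟨s, hs⟩) (by
        filter_upwards [hc] with x hx using hx ⟨s, hs⟩)
    rw [← hfix]
    refine (le_abs_self _).trans ((abs_pairFunctional_map_le u _ (A.norm_step_le p) _).trans ?_)
    refine (hu _ _).trans (mul_le_mul_of_nonneg_left ?_ hC)
    rw [hfix]
    refine Eq.trans_le ?_ (N.norm_map_le_extNorm _ (A.avg q p) A.norm_avg_le)
    change N.norm m (ampl p m X.subtype _) = _
    congr 1
    generalize jX e = v
    rw [ampl, ← LinearMap.comp_apply, ← LinearMap.comp_apply, ← TensorProduct.map_comp,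
      ← TensorProduct.map_comp]
    simp only [LinearMap.id_comp, LinearMap.comp_id]
  obtain ⟨Φ, hΦ, hΦN⟩ := exists_linear_extension_of_le_sublinear
    (TensorProduct.map LinearMap.id X.subtype ∘ₗ jX) (pairFunctional u ∘ₗ jX)
    (fun v => C * N.extNorm v) (fun c hc v => by rw [N.extNorm_smul hc]; ring)
    (fun v w => by rw [← mul_add]; exact mul_le_mul_of_nonneg_left (N.extNorm_add_le v w) hC)
    hbound
  refine ⟨Φ, fun s hs hμ x => ?_, fun n S hS t => ?_⟩
  · have := hΦ (Finsupp.single ⟨s, hs, hμ⟩ x)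
    simp only [LinearMap.comp_apply, hjX, Finsupp.lsum_apply, Finsupp.sum_single_index, map_zero,
      TensorProduct.mk_apply, TensorProduct.map_tmul, LinearMap.id_apply, hind,
      pairFunctional_tmul, lpPair_indicator, Submodule.subtype_apply] at this
    exact this
  · have h : ∀ t, Φ (TensorProduct.map S.toLinearMap LinearMap.id t) ≤ C * N.norm n t := fun t =>
      (hΦN _).trans (mul_le_mul_of_nonneg_left (N.extNorm_map_le S hS t) hC)
    refine abs_le.2 ⟨?_, h t⟩
    have := h (-t)
    rw [map_neg, map_neg, map_neg_eq_map] at this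
    linarith

end PMultinorm

end

/-! ### Countably additive parts of bounded finitely additive set functions. -/

noncomputable section

open MeasureTheory Set Filter Topology

variable {Ω : Type*} [MeasurableSpace Ω] {μ : Measure Ω}

/-- A finitely additive set function that is bounded above is, off a set of small measure,
asymptotically nonpositive on sets of small measure. -/
theorem exists_small_set_forall_le (m : Set Ω → ℝ) {E : Set Ω}
    (hadd : ∀ s t, MeasurableSet s → MeasurableSet t → s ⊆ E → t ⊆ E → Disjoint s t →
      m (s ∪ t) = m s + m t)
    {K : ℝ} (hK : ∀ s, MeasurableSet s → s ⊆ E → m s ≤ K) {ε : ℝ≥0∞} (hε : ε ≠ 0) :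
    ∃ B, MeasurableSet B ∧ B ⊆ E ∧ μ B ≤ ε ∧ ∀ η : ℝ, 0 < η → ∃ δ : ℝ≥0∞, δ ≠ 0 ∧
      ∀ s, MeasurableSet s → s ⊆ E \ B → μ s ≤ δ → m s ≤ η := by
  set V : ℝ≥0∞ → Set ℝ := fun δ => {r | ∃ s, MeasurableSet s ∧ s ⊆ E ∧ μ s ≤ δ ∧ r = m s} with hV
  have hm0 : m ∅ = 0 := by
    have := hadd ∅ ∅ .empty .empty (empty_subset _) (empty_subset _) (disjoint_empty _)
    rw [union_empty] at this
    linarith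
  have hVne : ∀ δ, (0 : ℝ) ∈ V δ := fun δ => ⟨∅, .empty, empty_subset _, by simp, hm0.symm⟩
  have hVbdd : ∀ δ, BddAbove (V δ) := by
    rintro δ
    refine ⟨K, ?_⟩
    rintro _ ⟨s, hs, hsE, -, rfl⟩
    exact hK s hs hsE
  have hle : ∀ δ s, MeasurableSet s → s ⊆ E → μ s ≤ δ → m s ≤ sSup (V δ) :=
    fun δ s hs hsE hδ => le_csSup (hVbdd δ) ⟨s, hs, hsE, hδ, rfl⟩
  set W : Set ℝ := {r | ∃ δ : ℝ≥0∞, δ ≠ 0 ∧ r = sSup (V δ)} with hW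
  have hWbdd : BddBelow W := by
    refine ⟨0, ?_⟩
    rintro _ ⟨δ, -, rfl⟩
    exact le_csSup (hVbdd δ) (hVne δ)
  have hWne : W.Nonempty := ⟨_, 1, one_ne_zero, rfl⟩
  -- `α` is the limit, as `δ → 0`, of the supremum of `m` over sets of measure at most `δ`. The set
  -- `B` is a union of small sets `A n` nearly attaining it. A small set off `B` with `m s > η`
  -- could be joined to some `A n`, giving a small set with value above `α + η / 2`.
  set α := sInf W with hα
  obtain ⟨e, he0, hesum⟩ := ENNReal.exists_pos_sum_of_countable hε ℕ
  have hchoose : ∀ n : ℕ, ∃ s, MeasurableSet s ∧ s ⊆ E ∧ μ s ≤ e n ∧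
      α - 1 / ((n : ℝ) + 1) < m s := by
    intro n
    have h1 : α ≤ sSup (V (e n)) :=
      csInf_le hWbdd ⟨e n, by simpa using (he0 n).ne', rfl⟩
    have h2 : α - 1 / ((n : ℝ) + 1) < sSup (V (e n)) :=
      (sub_lt_self α Nat.one_div_pos_of_nat).trans_le h1
    obtain ⟨_, ⟨s, hs, hsE, hμ, rfl⟩, hlt⟩ := exists_lt_of_lt_csSup ⟨0, hVne _⟩ h2
    exact ⟨s, hs, hsE, hμ, hlt⟩
  choose A hAm hAE hAμ hAlt using hchoose
  refine ⟨⋃ n, A n, MeasurableSet.iUnion hAm, iUnion_subset hAE, ?_, fun η hη => ?_⟩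
  · exact (measure_iUnion_le A).trans ((ENNReal.tsum_le_tsum hAμ).trans hesum.le)
  · obtain ⟨_, ⟨δ, hδ, rfl⟩, hlt⟩ := exists_lt_of_csInf_lt hWne
      (show sInf W < α + η / 2 by linarith)
    have hδ2 : δ / 2 ≠ 0 := by simpa using hδ
    have hev1 : ∀ᶠ n in atTop, (e n : ℝ≥0∞) ≤ δ / 2 :=
      (ENNReal.tendsto_atTop_zero_of_tsum_ne_top (ne_top_of_lt hesum)).eventually_le_const
        (pos_iff_ne_zero.2 hδ2)
    have hev2 : ∀ᶠ n : ℕ in atTop, 1 / ((n : ℝ) + 1) < η / 2 :=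
      tendsto_one_div_add_atTop_nhds_zero_nat.eventually_lt_const (half_pos hη)
    obtain ⟨n, hn1, hn2⟩ := (hev1.and hev2).exists
    refine ⟨δ / 2, hδ2, fun s hs hsE hμs => ?_⟩
    have hdisj : Disjoint s (A n) :=
      Set.disjoint_left.2 fun x hx hx' => (hsE hx).2 (mem_iUnion.2 ⟨n, hx'⟩)
    have hsE' : s ⊆ E := hsE.trans sdiff_subset
    have h1 := hadd s (A n) hs (hAm n) hsE' (hAE n) hdisj
    have h2 := hle δ (s ∪ A n) (hs.union (hAm n)) (union_subset hsE' (hAE n))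
      ((measure_union_le _ _).trans
        ((add_le_add hμs ((hAμ n).trans hn1)).trans_eq (ENNReal.add_halves δ)))
    have h3 := hAlt n
    linarith

/-- A bounded finitely additive set function is absolutely continuous off a set of small
measure. -/
theorem exists_small_set_absolutelyContinuous (m : Set Ω → ℝ) {E : Set Ω}
    (hadd : ∀ s t, MeasurableSet s → MeasurableSet t → s ⊆ E → t ⊆ E → Disjoint s t →
      m (s ∪ t) = m s + m t)
    {K : ℝ} (hK : ∀ s, MeasurableSet s → s ⊆ E → |m s| ≤ K) {ε : ℝ≥0∞} (hε : ε ≠ 0) :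
    ∃ B, MeasurableSet B ∧ B ⊆ E ∧ μ B ≤ ε ∧ ∀ η : ℝ, 0 < η → ∃ δ : ℝ≥0∞, δ ≠ 0 ∧
      ∀ s, MeasurableSet s → s ⊆ E \ B → μ s ≤ δ → |m s| ≤ η := by
  have hε2 : ε / 2 ≠ 0 := by simpa using hε
  obtain ⟨B, hB, hBE, hBμ, h⟩ := exists_small_set_forall_le (μ := μ) m hadd
    (fun s hs hsE => (le_abs_self _).trans (hK s hs hsE)) hε2
  obtain ⟨B', hB', hBE', hBμ', h'⟩ := exists_small_set_forall_le (μ := μ) (fun s => -m s)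
    (fun s t hs ht hsE htE hd => by rw [hadd s t hs ht hsE htE hd]; ring)
    (fun s hs hsE => (neg_le_abs _).trans (hK s hs hsE)) hε2
  refine ⟨B ∪ B', hB.union hB', union_subset hBE hBE', ?_, fun η hη => ?_⟩
  · exact (measure_union_le _ _).trans ((add_le_add hBμ hBμ').trans_eq (ENNReal.add_halves ε))
  · obtain ⟨δ, hδ, h1⟩ := h η hη
    obtain ⟨δ', hδ', h2⟩ := h' η hη
    refine ⟨min δ δ', by simp [min_eq_iff, hδ, hδ'], fun s hs hsE hμ => abs_le.2 ⟨?_, ?_⟩⟩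
    · have := h2 s hs (hsE.trans (sdiff_subset_sdiff_right subset_union_right))
        (hμ.trans (min_le_right _ _))
      linarith
    · exact h1 s hs (hsE.trans (sdiff_subset_sdiff_right subset_union_left))
        (hμ.trans (min_le_left _ _))

/-- A finitely additive set function that is absolutely continuous on `D` has a density there. -/
theorem exists_density_of_absolutelyContinuous [SigmaFinite μ] (m : Set Ω → ℝ) {D : Set Ω}
    (hD : MeasurableSet D) (hμD : μ D ≠ ∞)
    (hadd : ∀ s t, MeasurableSet s → MeasurableSet t → s ⊆ D → t ⊆ D → Disjoint s t →
      m (s ∪ t) = m s + m t)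
    (hac : ∀ η : ℝ, 0 < η → ∃ δ : ℝ≥0∞, δ ≠ 0 ∧
      ∀ s, MeasurableSet s → s ⊆ D → μ s ≤ δ → |m s| ≤ η) :
    ∃ f : Ω → ℝ, Measurable f ∧ Integrable f μ ∧
      ∀ s, MeasurableSet s → s ⊆ D → m s = ∫ x in s, f x ∂μ := by
  classical
  have hm0 : m ∅ = 0 := by
    have := hadd ∅ ∅ .empty .empty (empty_subset _) (empty_subset _) (disjoint_empty _)
    rw [union_empty] at this
    linarith
  have hsum : ∀ f : ℕ → Set Ω, (∀ i, MeasurableSet (f i)) → Pairwise (Function.onFun Disjoint f) →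
      HasSum (fun i => m (f i ∩ D)) (m ((⋃ i, f i) ∩ D)) := by
    intro f hf hd
    have hfin : ∀ F : Finset ℕ, ∑ i ∈ F, m (f i ∩ D) = m ((⋃ i ∈ F, f i) ∩ D) := by
      intro F
      induction F using Finset.induction_on with
      | empty => simp [hm0]
      | insert i F hi ih =>
        rw [Finset.sum_insert hi, ih, Finset.set_biUnion_insert, union_inter_distrib_right]
        refine (hadd _ _ ((hf i).inter hD) ((F.measurableSet_biUnion fun j _ => hf j).inter hD)
          inter_subset_right inter_subset_right ?_).symm
        refine Disjoint.mono inter_subset_left inter_subset_left ?_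
        refine Set.disjoint_iUnion₂_right.2 fun j hj => hd ?_
        rintro rfl
        exact hi hj
    have htsum : ∑' i, μ (f i ∩ D) ≠ ∞ := by
      rw [← measure_iUnion (fun i j hij => (hd hij).mono inter_subset_left inter_subset_left)
        fun i => (hf i).inter hD]
      exact ne_top_of_le_ne_top hμD (measure_mono (iUnion_subset fun i => inter_subset_right))
    have htail := ENNReal.tendsto_tsum_compl_atTop_zero htsum
    -- The tails of a disjoint union inside `D` have measure tending to 0, so absolute continuity
    -- upgrades finite to countable additivity.
    refine Metric.tendsto_nhds.2 fun η hη => ?_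
    obtain ⟨δ, hδ, h⟩ := hac (η / 2) (half_pos hη)
    filter_upwards [htail.eventually_le_const (pos_iff_ne_zero.2 hδ)] with F hF
    have hrest : MeasurableSet (⋃ i : {i // i ∉ F}, f i ∩ D) :=
      MeasurableSet.iUnion fun i => (hf i).inter hD
    have hsplit : m ((⋃ i, f i) ∩ D) =
        m ((⋃ i ∈ F, f i) ∩ D) + m (⋃ i : {i // i ∉ F}, f i ∩ D) := by
      rw [← hadd _ _ ((F.measurableSet_biUnion fun j _ => hf j).inter hD) hrest inter_subset_right
        (iUnion_subset fun i => inter_subset_right)]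
      · congr 1
        ext x
        simp only [mem_inter_iff, mem_iUnion, mem_union, Subtype.exists, exists_prop]
        constructor
        · rintro ⟨⟨i, hi⟩, hx⟩
          by_cases hiF : i ∈ F
          · exact Or.inl ⟨⟨i, hiF, hi⟩, hx⟩
          · exact Or.inr ⟨i, hiF, hi, hx⟩
        · rintro (⟨⟨i, -, hi⟩, hx⟩ | ⟨i, -, hi, hx⟩) <;> exact ⟨⟨i, hi⟩, hx⟩
      · refine Set.disjoint_left.2 ?_
        rintro x ⟨hx, -⟩ hx'
        obtain ⟨i, hi, hxi⟩ := mem_iUnion₂.1 hx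
        obtain ⟨⟨j, hj⟩, hxj, -⟩ := mem_iUnion.1 hx'
        refine (hd (i := i) (j := j) ?_).le_bot ⟨hxi, hxj⟩
        rintro rfl
        exact hj hi
    have hsmall := h _ hrest (iUnion_subset fun i => inter_subset_right)
      ((measure_iUnion_le _).trans hF)
    rw [hfin, Real.dist_eq, hsplit, sub_add_cancel_left, abs_neg]
    linarith
  let ν : SignedMeasure Ω :=
    { measureOf' := fun s => if MeasurableSet s then m (s ∩ D) else 0
      empty' := by simp [hm0]
      not_measurable' := fun s hs => by simp [hs]
      m_iUnion' := fun f hf hd => by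
        simp only [hf, MeasurableSet.iUnion hf, if_true]
        exact hsum f hf hd }
  have hν : ∀ s, MeasurableSet s → ν s = m (s ∩ D) := fun s hs => if_pos hs
  have hνμ : VectorMeasure.AbsolutelyContinuous ν μ.toENNRealVectorMeasure := by
    refine VectorMeasure.AbsolutelyContinuous.mk fun s hs h0 => ?_
    rw [Measure.toENNRealVectorMeasure_apply_measurable hs] at h0
    rw [hν s hs]
    refine abs_nonpos_iff.1 (le_of_forall_pos_le_add fun η hη => ?_)
    obtain ⟨δ, -, h⟩ := hac η hη
    rw [zero_add]
    exact h _ (hs.inter hD) inter_subset_right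
      ((measure_mono inter_subset_left).trans (h0.trans_le zero_le))
  refine ⟨ν.rnDeriv μ, ν.measurable_rnDeriv μ, ν.integrable_rnDeriv μ, fun s hs hsD => ?_⟩
  rw [← withDensityᵥ_apply (ν.integrable_rnDeriv μ) hs, ν.withDensityᵥ_rnDeriv_eq μ hνμ, hν s hs,
    inter_eq_left.2 hsD]

end

/-! ### Densities of functionals on `L^p`. -/

noncomputable section

open MeasureTheory Set Filter Topology

variable {Ω : Type*} [MeasurableSpace Ω] {μ : Measure Ω} {p : ℝ≥0∞}

theorem memLp_of_bounded_on {f : Ω → ℝ} (hf : Measurable f) {D : Set Ω} (hD : MeasurableSet D)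
    (hμD : μ D ≠ ∞) {M : ℝ} (hM : ∀ x ∈ D, |f x| ≤ M) : MemLp (D.indicator f) p μ := by
  rw [memLp_indicator_iff_restrict hD]
  have := Fact.mk hμD.lt_top
  exact MemLp.of_bound hf.aestronglyMeasurable M (by
    filter_upwards [ae_restrict_mem hD] with x hx using hM x hx)

/-- On `D`, the functional `φ` on `L^p` is integration against `f`. -/
structure IsDensityOn (φ : Lp ℝ p μ →ₗ[ℝ] ℝ) (f : Ω → ℝ) (D : Set Ω) : Prop where
  measurableSet : MeasurableSet D
  ne_top : μ D ≠ ∞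
  integrableOn : IntegrableOn f D μ
  apply_eq : ∀ (s : Set Ω) (hs : MeasurableSet s) (hμ : μ s ≠ ∞), s ⊆ D →
    φ (indicatorConstLp p hs hμ 1) = ∫ x in s, f x ∂μ

namespace IsDensityOn

variable {φ ψ : Lp ℝ p μ →ₗ[ℝ] ℝ} {f g : Ω → ℝ} {D D' : Set Ω}

theorem mono (h : IsDensityOn φ f D) (hD' : MeasurableSet D') (hsub : D' ⊆ D) :
    IsDensityOn φ f D' where
  measurableSet := hD'
  ne_top := ne_top_of_le_ne_top h.ne_top (measure_mono hsub)
  integrableOn := h.integrableOn.mono_set hsub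
  apply_eq s hs hμ hsD := h.apply_eq s hs hμ (hsD.trans hsub)

theorem congr (h : IsDensityOn φ f D) (hfg : EqOn f g D) : IsDensityOn φ g D where
  measurableSet := h.measurableSet
  ne_top := h.ne_top
  integrableOn := h.integrableOn.congr_fun hfg h.measurableSet
  apply_eq s hs hμ hsD := by
    rw [h.apply_eq s hs hμ hsD]
    exact setIntegral_congr_fun hs fun x hx => hfg (hsD hx)

theorem union (h : IsDensityOn φ f D) (h' : IsDensityOn φ f D') (hd : Disjoint D D') :
    IsDensityOn φ f (D ∪ D') where
  measurableSet := h.measurableSet.union h'.measurableSet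
  ne_top := (measure_union_lt_top h.ne_top.lt_top h'.ne_top.lt_top).ne
  integrableOn := h.integrableOn.union h'.integrableOn
  apply_eq s hs hμ hsD := by
    have h1 := hs.inter h.measurableSet
    have h2 := hs.inter h'.measurableSet
    have hμ1 : μ (s ∩ D) ≠ ∞ := ne_top_of_le_ne_top hμ (measure_mono inter_subset_left)
    have hμ2 : μ (s ∩ D') ≠ ∞ := ne_top_of_le_ne_top hμ (measure_mono inter_subset_left)
    have hdd : Disjoint (s ∩ D) (s ∩ D') := hd.mono inter_subset_right inter_subset_right
    have hu : s ∩ D ∪ s ∩ D' = s := by rw [← inter_union_distrib_left, inter_eq_left.2 hsD]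
    have e : indicatorConstLp p hs hμ (1 : ℝ) =
        indicatorConstLp p h1 hμ1 1 + indicatorConstLp p h2 hμ2 1 := by
      rw [← indicatorConstLp_disjoint_union h1 h2 hμ1 hμ2 hdd]
      congr 1
      exact hu.symm
    rw [e, map_add, h.apply_eq _ h1 hμ1 inter_subset_right,
      h'.apply_eq _ h2 hμ2 inter_subset_right,
      ← setIntegral_union hdd h2 (h.integrableOn.mono_set inter_subset_right)
        (h'.integrableOn.mono_set inter_subset_right), hu]

theorem add (h : IsDensityOn φ f D) (h' : IsDensityOn ψ g D) :
    IsDensityOn (φ + ψ) (f + g) D where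
  measurableSet := h.measurableSet
  ne_top := h.ne_top
  integrableOn := h.integrableOn.add h'.integrableOn
  apply_eq s hs hμ hsD := by
    rw [LinearMap.add_apply, h.apply_eq s hs hμ hsD, h'.apply_eq s hs hμ hsD]
    exact (integral_add (h.integrableOn.mono_set hsD) (h'.integrableOn.mono_set hsD)).symm

theorem smul (h : IsDensityOn φ f D) (c : ℝ) : IsDensityOn (c • φ) (c • f) D where
  measurableSet := h.measurableSet
  ne_top := h.ne_top
  integrableOn := h.integrableOn.smul c
  apply_eq s hs hμ hsD := by
    rw [LinearMap.smul_apply, h.apply_eq s hs hμ hsD]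
    exact (integral_smul c f).symm

theorem ae_eq (h : IsDensityOn φ f D) (h' : IsDensityOn φ g D) : f =ᵐ[μ.restrict D] g := by
  refine Integrable.ae_eq_of_forall_setIntegral_eq f g h.integrableOn h'.integrableOn
    fun s hs _ => ?_
  have hμ : μ (s ∩ D) ≠ ∞ := ne_top_of_le_ne_top h.ne_top (measure_mono inter_subset_right)
  rw [Measure.restrict_restrict hs,
    ← h.apply_eq _ (hs.inter h.measurableSet) hμ inter_subset_right,
    ← h'.apply_eq _ (hs.inter h.measurableSet) hμ inter_subset_right]

end IsDensityOn

/-- Off arbitrarily small sets, a bounded functional on `L^p` has a density. -/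
theorem exists_isDensityOn [SigmaFinite μ] (φ : Lp ℝ p μ →ₗ[ℝ] ℝ) {C : ℝ}
    (hφ : ∀ f, |φ f| ≤ C * ‖f‖) (hC : 0 ≤ C) {E : Set Ω} (hE : MeasurableSet E) (hμE : μ E ≠ ∞)
    {ε : ℝ≥0∞} (hε : ε ≠ 0) :
    ∃ (D : Set Ω) (f : Ω → ℝ), D ⊆ E ∧ μ (E \ D) ≤ ε ∧ Measurable f ∧ IsDensityOn φ f D := by
  classical
  -- On subsets of `E`, `s ↦ φ(1_s)` is finitely additive and bounded; the value `0` elsewhere is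
  -- never used.
  set m : Set Ω → ℝ := fun s =>
    if h : MeasurableSet s ∧ μ s ≠ ∞ then φ (indicatorConstLp p h.1 h.2 1) else 0 with hm
  have hfin : ∀ s, s ⊆ E → μ s ≠ ∞ := fun s hs => ne_top_of_le_ne_top hμE (measure_mono hs)
  have hm1 : ∀ s (hs : MeasurableSet s) (hμ : μ s ≠ ∞), m s = φ (indicatorConstLp p hs hμ 1) :=
    fun s hs hμ => dif_pos ⟨hs, hμ⟩
  have hadd : ∀ s t, MeasurableSet s → MeasurableSet t → s ⊆ E → t ⊆ E → Disjoint s t →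
      m (s ∪ t) = m s + m t := by
    intro s t hs ht hsE htE hd
    rw [hm1 s hs (hfin s hsE), hm1 t ht (hfin t htE), hm1 _ (hs.union ht)
      (hfin _ (union_subset hsE htE)), ← map_add, indicatorConstLp_disjoint_union hs ht
      (hfin s hsE) (hfin t htE) hd]
  have hbdd : ∀ s, MeasurableSet s → s ⊆ E →
      |m s| ≤ C * μ.real E ^ (1 / p.toReal) := by
    intro s hs hsE
    rw [hm1 s hs (hfin s hsE)]
    refine (hφ _).trans (mul_le_mul_of_nonneg_left ?_ hC)
    refine norm_indicatorConstLp_le.trans ?_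
    rw [norm_one, one_mul]
    exact Real.rpow_le_rpow measureReal_nonneg (measureReal_mono hsE hμE) (by positivity)
  obtain ⟨B, hB, hBE, hBμ, hac⟩ := exists_small_set_absolutelyContinuous (μ := μ) m hadd hbdd hε
  have hDE : E \ B ⊆ E := sdiff_subset
  obtain ⟨f, hf, hfi, hfm⟩ := exists_density_of_absolutelyContinuous (μ := μ) m (hE.diff hB)
    (hfin _ hDE)
    (fun s t hs ht hsE htE hd => hadd s t hs ht (hsE.trans hDE) (htE.trans hDE) hd) hac
  refine ⟨E \ B, f, hDE, ?_, hf, hE.diff hB, hfin _ hDE, hfi.integrableOn, fun s hs hμ hsD => ?_⟩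
  · rwa [sdiff_sdiff_cancel_left hBE]
  · rw [← hfm s hs hsD, hm1 s hs hμ]

/-- `f` is the density of the countably additive part of the functional `φ` on `L^p`: on an
increasing sequence of sets with conull union, `φ` is integration against `f`. -/
structure IsDensity (φ : Lp ℝ p μ →ₗ[ℝ] ℝ) (f : Ω → ℝ) : Prop where
  measurable : Measurable f
  exists_exhaustion : ∃ D : ℕ → Set Ω, Monotone D ∧ (∀ k, IsDensityOn φ f (D k)) ∧
    ∀ᵐ x ∂μ, ∃ k, x ∈ D k

namespace IsDensity

variable {φ ψ : Lp ℝ p μ →ₗ[ℝ] ℝ} {f g : Ω → ℝ}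

/-- Both exhaustions are increasing, so the sets `D k ∩ D' k` still cover almost every point. -/
theorem add (h : IsDensity φ f) (h' : IsDensity ψ g) : IsDensity (φ + ψ) (f + g) := by
  obtain ⟨D, hD, hφ, hc⟩ := h.exists_exhaustion
  obtain ⟨D', hD', hψ, hc'⟩ := h'.exists_exhaustion
  refine ⟨h.measurable.add h'.measurable, fun k => D k ∩ D' k,
    fun i j hij => inter_subset_inter (hD hij) (hD' hij), fun k => ?_, ?_⟩
  · have hm := (hφ k).measurableSet.inter (hψ k).measurableSet
    exact ((hφ k).mono hm inter_subset_left).add ((hψ k).mono hm inter_subset_right)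
  · filter_upwards [hc, hc'] with x ⟨i, hi⟩ ⟨j, hj⟩
    exact ⟨max i j, hD (le_max_left _ _) hi, hD' (le_max_right _ _) hj⟩

theorem smul (h : IsDensity φ f) (c : ℝ) : IsDensity (c • φ) (c • f) := by
  obtain ⟨D, hD, hφ, hc⟩ := h.exists_exhaustion
  exact ⟨h.measurable.const_smul c, D, hD, fun k => (hφ k).smul c, hc⟩

/-- On each `D k ∩ D' k` both functions have the same integrals over measurable subsets. This
uniqueness yields both linearity of the extension and its agreement with `u`. -/
theorem ae_eq (h : IsDensity φ f) (h' : IsDensity φ g) : f =ᵐ[μ] g := by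
  obtain ⟨D, hD, hφ, hc⟩ := h.exists_exhaustion
  obtain ⟨D', hD', hψ, hc'⟩ := h'.exists_exhaustion
  have key : ∀ k, ∀ᵐ x ∂μ, x ∈ D k ∩ D' k → f x = g x := by
    intro k
    have hm := (hφ k).measurableSet.inter (hψ k).measurableSet
    exact (ae_restrict_iff' hm).1
      (((hφ k).mono hm inter_subset_left).ae_eq ((hψ k).mono hm inter_subset_right))
  filter_upwards [hc, hc', ae_all_iff.2 key] with x ⟨i, hi⟩ ⟨j, hj⟩ hx
  exact hx (max i j) ⟨hD (le_max_left _ _) hi, hD' (le_max_right _ _) hj⟩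

/-- A common exhaustion for finitely many densities, on which they are bounded. -/
theorem exists_common_exhaustion {κ : Type*} [Finite κ] {φ : κ → Lp ℝ p μ →ₗ[ℝ] ℝ}
    {f : κ → Ω → ℝ} (h : ∀ k, IsDensity (φ k) (f k)) [SigmaFinite μ] :
    ∃ D : ℕ → Set Ω, Monotone D ∧ (∀ n, MeasurableSet (D n)) ∧ (∀ n, μ (D n) ≠ ∞) ∧
      (∀ n k, IsDensityOn (φ k) (f k) (D n)) ∧ (∀ n k, ∀ x ∈ D n, |f k x| ≤ n) ∧
      ∀ᵐ x ∂μ, ∃ n, x ∈ D n := by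
  choose D hD hφ hc using fun k => (h k).exists_exhaustion
  have hE : ∀ n : ℕ, MeasurableSet (⋂ k, D k n ∩ {x | |f k x| ≤ n}) := fun n =>
    MeasurableSet.iInter fun k => (hφ k n).measurableSet.inter
      (measurableSet_le (measurable_norm.comp (h k).measurable) measurable_const)
  have hF : ∀ n : ℕ, MeasurableSet (spanningSets μ n ∩ ⋂ k, D k n ∩ {x | |f k x| ≤ n}) := fun n =>
    (measurableSet_spanningSets μ n).inter (hE n)
  refine ⟨fun n => spanningSets μ n ∩ ⋂ k, D k n ∩ {x | |f k x| ≤ n}, fun i j hij => ?_, hF,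
    fun n => ne_top_of_le_ne_top (measure_spanningSets_lt_top μ n).ne
      (measure_mono inter_subset_left), fun n k => ?_, fun n k x hx => ?_, ?_⟩
  · refine inter_subset_inter (monotone_spanningSets μ hij) (iInter_mono fun k => ?_)
    exact inter_subset_inter (hD k hij) fun x (hx : |f k x| ≤ i) =>
      show |f k x| ≤ j from hx.trans (Nat.cast_le.2 hij)
  · exact (hφ k n).mono (hF n) fun x hx => (mem_iInter.1 hx.2 k).1
  · exact (mem_iInter.1 hx.2 k).2
  · filter_upwards [ae_all_iff.2 hc] with x hx
    choose a ha using hx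
    have h1 : ∀ᶠ n in atTop, x ∈ spanningSets μ n := by
      obtain ⟨n, hn⟩ := mem_iUnion.1 ((iUnion_spanningSets μ).symm ▸ mem_univ x)
      exact eventually_atTop.2 ⟨n, fun b hb => monotone_spanningSets μ hb hn⟩
    have h2 : ∀ k, ∀ᶠ n : ℕ in atTop, x ∈ D k n ∩ {x | |f k x| ≤ n} := by
      intro k
      filter_upwards [eventually_ge_atTop (a k), eventually_ge_atTop ⌈|f k x|⌉₊] with n hn hn'
      exact ⟨hD k hn (ha k), show |f k x| ≤ n from (Nat.le_ceil _).trans (Nat.cast_le.2 hn')⟩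
    obtain ⟨n, hn1, hn2⟩ := (h1.and (eventually_all.2 h2)).exists
    exact ⟨n, hn1, mem_iInter.2 hn2⟩

theorem of_lp [SigmaFinite μ] {q : ℝ≥0∞} [hq : Fact (1 ≤ q)] (φ : Lp ℝ p μ →ₗ[ℝ] ℝ) (g : Lp ℝ q μ)
    (h : ∀ (s : Set Ω) (hs : MeasurableSet s) (hμ : μ s ≠ ∞),
      φ (indicatorConstLp p hs hμ 1) = ∫ x in s, g x ∂μ) : IsDensity φ g := by
  refine ⟨(Lp.stronglyMeasurable g).measurable, spanningSets μ, monotone_spanningSets μ,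
    fun k => ⟨measurableSet_spanningSets μ k, (measure_spanningSets_lt_top μ k).ne, ?_,
      fun s hs hμ _ => h s hs hμ⟩, ?_⟩
  · have := Fact.mk (measure_spanningSets_lt_top μ k)
    exact ((Lp.memLp g).restrict _).integrable hq.out
  · refine ae_of_all μ fun x => ?_
    exact mem_iUnion.1 ((iUnion_spanningSets μ).symm ▸ mem_univ x)

theorem congr_ae (h : IsDensity φ f)
    (hg : Measurable g) (hfg : f =ᵐ[μ] g) : IsDensity φ g := by
  obtain ⟨D, hD, hφ, hc⟩ := h.exists_exhaustion
  refine ⟨hg, D, hD, fun k => ⟨(hφ k).measurableSet, (hφ k).ne_top,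
    (hφ k).integrableOn.congr (ae_restrict_of_ae hfg), fun s hs hμ hsD => ?_⟩, hc⟩
  rw [(hφ k).apply_eq s hs hμ hsD]
  exact setIntegral_congr_ae hs (hfg.mono fun x hx _ => hx)

end IsDensity

/-- `Nat.unpair` runs through all pairs of a spanning set and a tolerance `1 / (n + 1)`. The
resulting good sets miss only a null set, and their densities are glued over the disjointed sets. -/
theorem exists_isDensity [SigmaFinite μ] (φ : Lp ℝ p μ →ₗ[ℝ] ℝ) {C : ℝ}
    (hφ : ∀ f, |φ f| ≤ C * ‖f‖) (hC : 0 ≤ C) : ∃ f, IsDensity φ f := by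
  choose D f hDE hDμ hf hD using fun k : ℕ => exists_isDensityOn φ hφ hC
    (measurableSet_spanningSets μ k.unpair.1) (measure_spanningSets_lt_top μ k.unpair.1).ne
    (ε := ((k.unpair.2 : ℝ≥0∞) + 1)⁻¹) (by simp)
  have hdm : ∀ k, MeasurableSet (disjointed D k) := fun k =>
    MeasurableSet.disjointed (fun k => (hD k).measurableSet) k
  obtain ⟨g, hg, hgf⟩ := exists_measurable_piecewise (disjointed D) hdm f hf (by
    intro i j hij x hx
    exact absurd hx (Set.disjoint_left.1 (disjoint_disjointed D hij) hx.1 |> fun h h' => h h'.2))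
  have h1 : ∀ k, IsDensityOn φ g (disjointed D k) := fun k =>
    ((hD k).mono (hdm k) (disjointed_subset D k)).congr fun x hx => (hgf k hx).symm
  have h2 : ∀ k, IsDensityOn φ g (accumulate (disjointed D) k) := by
    intro k
    induction k with
    | zero => simpa [accumulate] using h1 0
    | succ k ih =>
      rw [accumulate_succ]
      refine ih.union (h1 _) ?_
      refine Set.disjoint_left.2 fun x hx hx' => ?_
      obtain ⟨j, hj, hxj⟩ := mem_accumulate.1 hx
      exact (disjoint_disjointed D (show j ≠ k + 1 by omega)).le_bot ⟨hxj, hx'⟩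
  refine ⟨g, hg, accumulate (disjointed D), monotone_accumulate, h2, ?_⟩
  have h3 : ∀ j, μ (spanningSets μ j \ ⋃ k, D k) = 0 := by
    intro j
    have h4 : ∀ n : ℕ, μ (spanningSets μ j \ ⋃ k, D k) ≤ ((n : ℝ≥0∞) + 1)⁻¹ := by
      intro n
      have := hDμ (Nat.pair j n)
      simp only [Nat.unpair_pair] at this
      exact (measure_mono (sdiff_subset_sdiff_right (subset_iUnion D _))).trans this
    have h5 : Tendsto (fun n : ℕ => ((n : ℝ≥0∞) + 1)⁻¹) atTop (𝓝 0) := by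
      simpa [Function.comp_def] using
        ENNReal.tendsto_inv_nat_nhds_zero.comp (tendsto_add_atTop_nat 1)
    exact le_antisymm (ge_of_tendsto' h5 h4) zero_le
  have h5 : ∀ᵐ x ∂μ, ∀ j, x ∉ spanningSets μ j \ ⋃ k, D k :=
    ae_all_iff.2 fun j => measure_eq_zero_iff_ae_notMem.1 (h3 j)
  filter_upwards [h5] with x hx
  obtain ⟨j, hj⟩ := mem_iUnion.1 ((iUnion_spanningSets μ).symm ▸ mem_univ x)
  have h6 : x ∈ ⋃ k, D k := by_contra fun h => hx j ⟨hj, h⟩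
  rw [← iUnion_disjointed] at h6
  obtain ⟨k, hk⟩ := mem_iUnion.1 h6
  exact ⟨k, mem_accumulate.2 ⟨k, le_rfl, hk⟩⟩

end

/-! ### The projective norm bound for truncated densities. -/

noncomputable section

open MeasureTheory Set Filter Topology

variable {Ω : Type*} [MeasurableSpace Ω] {μ : Measure Ω}
  {p q : ℝ≥0∞} [Fact (1 ≤ p)] [Fact (1 ≤ q)] [p.HolderConjugate q]

section ProjNorm

variable {E F : Type*} [NormedAddCommGroup E] [NormedSpace ℝ E]
  [NormedAddCommGroup F] [NormedSpace ℝ F]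

theorem projNorm_sum_tmul_le {κ : Type*} [Fintype κ] (a : κ → E) (x : κ → F) :
    projNorm (∑ k, a k ⊗ₜ[ℝ] x k) ≤ ∑ k, ‖a k‖ * ‖x k‖ :=
  (Finset.le_sum_of_subadditive projNorm projNorm_zero.le projNorm_add_le _ _).trans
    (Finset.sum_le_sum fun k _ => projNorm_tmul_le (a k) (x k))

theorem projNorm_sum_tmul_le_add {κ : Type*} [Fintype κ] (a : κ → E) (x y : κ → F) :
    projNorm (∑ k, a k ⊗ₜ[ℝ] x k) ≤
      projNorm (∑ k, a k ⊗ₜ[ℝ] y k) + ∑ k, ‖a k‖ * ‖x k - y k‖ := by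
  have e : ∑ k, a k ⊗ₜ[ℝ] x k = ∑ k, a k ⊗ₜ[ℝ] y k + ∑ k, a k ⊗ₜ[ℝ] (x k - y k) := by
    simp only [TensorProduct.tmul_sub, Finset.sum_sub_distrib, add_sub_cancel]
  rw [e]
  exact (projNorm_add_le _ _).trans (add_le_add_right (projNorm_sum_tmul_le _ _) _)

end ProjNorm

/-- The contraction of `ℓ^p_n` into `ℓ^p_m` induced by a functional on `ℓ^p_n ⊗ L^q` and an atom
family. -/
theorem AtomFamily.exists_contraction {m n : ℕ} (A : AtomFamily μ m)
    (B : EllP p n ⊗[ℝ] Lp ℝ q μ →ₗ[ℝ] ℝ) (hB : ∀ v, B v ≤ projNorm v) :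
    ∃ T : EllP p n →L[ℝ] EllP p m, ‖T‖ ≤ 1 ∧
      ∀ a i, T a i = (A.weight q i)⁻¹ * B (a ⊗ₜ A.ind q i) := by
  let T : EllP p n →ₗ[ℝ] EllP p m :=
    { toFun := fun a => WithLp.toLp p fun i => (A.weight q i)⁻¹ * B (a ⊗ₜ A.ind q i)
      map_add' := fun a b => by ext i; simp [TensorProduct.add_tmul, mul_add]
      map_smul' := fun c a => by
        ext i
        simp only [← TensorProduct.smul_tmul', map_smul, smul_eq_mul, RingHom.id_apply,
          PiLp.smul_apply]
        ring }
  have hT : ∀ a, ‖T a‖ ≤ 1 * ‖a‖ := by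
    intro a
    rw [one_mul]
    refine EllP.norm_le_of_pairing_le (q := q) _ (norm_nonneg a) fun c => ?_
    have e : ∑ i, T a i * c i = B (a ⊗ₜ A.step q c) := by
      rw [A.step_apply, TensorProduct.tmul_sum, map_sum]
      refine Finset.sum_congr rfl fun i _ => ?_
      rw [TensorProduct.tmul_smul, map_smul, smul_eq_mul]
      change (A.weight q i)⁻¹ * B (a ⊗ₜ A.ind q i) * c i = _
      ring
    rw [e]
    exact (hB _).trans ((projNorm_tmul_le _ _).trans
      (mul_le_mul_of_nonneg_left (A.norm_stepₗ_le q c) (norm_nonneg _)))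
  exact ⟨T.mkContinuous 1 hT, LinearMap.mkContinuous_norm_le _ zero_le_one _, fun a i => rfl⟩

/-- Step function approximation of a bounded function in the `L^q` norm. -/
theorem AtomFamily.norm_sub_sum_avg_le {m : ℕ} (A : AtomFamily μ m) {D : Set Ω}
    (hD : MeasurableSet D) (hμD : μ D ≠ ∞) (hAD : ∀ i, A.set i ⊆ D)
    (hc : ∀ᵐ x ∂μ, x ∈ D → ∃ i, x ∈ A.set i) {f : Ω → ℝ} {g : Lp ℝ q μ}
    (hg : g =ᵐ[μ] D.indicator f) {c : Fin m → ℝ} {ε : ℝ} (hε : 0 ≤ ε)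
    (hf : ∀ i, ∀ x ∈ A.set i, |f x - c i| ≤ ε) :
    ‖g - ∑ i, c i • A.ind q i‖ ≤ ε * μ.real D ^ (1 / q.toReal) := by
  have h1 : ‖g - ∑ i, c i • A.ind q i‖ ≤ ‖indicatorConstLp q hD hμD ε‖ := by
    refine Lp.norm_le_norm_of_ae_le ?_
    filter_upwards [Lp.coeFn_sub g (∑ i, c i • A.ind q i), hg, A.sum_smul_ind_coeFn q c, hc,
      indicatorConstLp_coeFn (p := q) (hs := hD) (hμs := hμD) (c := ε)] with x h1 h2 h3 h4 h5
    rw [h1, Pi.sub_apply, h2, h3, h5]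
    by_cases hx : x ∈ D
    · obtain ⟨i, hi⟩ := h4 hx
      rw [A.sum_indicator_of_mem c hi, indicator_of_mem hx, indicator_of_mem hx,
        Real.norm_of_nonneg hε]
      exact hf i x hi
    · rw [A.sum_indicator_of_notMem c fun i hi => hx (hAD i hi), indicator_of_notMem hx,
        indicator_of_notMem hx, sub_zero]
  refine h1.trans (norm_indicatorConstLp_le.trans_eq ?_)
  rw [Real.norm_of_nonneg hε]

namespace PMultinorm

variable {Y : Type*} [NormedAddCommGroup Y] [NormedSpace ℝ Y]

/-- The functional `f ↦ Φ (f ⊗ y)`. -/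
def slice {Z : Type*} [AddCommGroup Z] [Module ℝ Z] (Φ : Z ⊗[ℝ] Y →ₗ[ℝ] ℝ) (y : Y) :
    Z →ₗ[ℝ] ℝ :=
  Φ ∘ₗ (TensorProduct.mk ℝ Z Y).flip y

theorem slice_apply {Z : Type*} [AddCommGroup Z] [Module ℝ Z] (Φ : Z ⊗[ℝ] Y →ₗ[ℝ] ℝ) (y : Y)
    (z : Z) : slice Φ y z = Φ (z ⊗ₜ y) := rfl

theorem slice_add {Z : Type*} [AddCommGroup Z] [Module ℝ Z] (Φ : Z ⊗[ℝ] Y →ₗ[ℝ] ℝ) (y y' : Y) :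
    slice Φ (y + y') = slice Φ y + slice Φ y' := by
  ext z; simp [slice_apply, TensorProduct.tmul_add]

theorem slice_smul {Z : Type*} [AddCommGroup Z] [Module ℝ Z] (Φ : Z ⊗[ℝ] Y →ₗ[ℝ] ℝ) (c : ℝ)
    (y : Y) : slice Φ (c • y) = c • slice Φ y := by
  ext z; simp [slice_apply]

variable [CompleteSpace Y]

/-- The functional `Φ` on `Z ⊗ Y` is bounded by `C` with respect to the multinorm of `Y`, along
all contractions from the spaces `ℓ^p_n`. -/
def IsBoundedBy {Z : Type*} [NormedAddCommGroup Z] [NormedSpace ℝ Z] (N : PMultinorm p Y)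
    (C : ℝ) (Φ : Z ⊗[ℝ] Y →ₗ[ℝ] ℝ) : Prop :=
  ∀ (n : ℕ) (S : EllP p n →L[ℝ] Z), ‖S‖ ≤ 1 → ∀ t : EllP p n ⊗[ℝ] Y,
    |Φ (TensorProduct.map S.toLinearMap LinearMap.id t)| ≤ C * N.norm n t

/-- A single `z` is the image of a vector of norm `‖z‖` in `ℓ^p_1` under a rank-one contraction, so
the bound at level 1 suffices. -/
theorem IsBoundedBy.abs_slice_le {Z : Type*} [NormedAddCommGroup Z] [NormedSpace ℝ Z]
    {N : PMultinorm p Y} {C : ℝ} {Φ : Z ⊗[ℝ] Y →ₗ[ℝ] ℝ} (hΦ : N.IsBoundedBy C Φ) (y : Y) (z : Z) :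
    |slice Φ y z| ≤ C * ‖y‖ * ‖z‖ := by
  rcases eq_or_ne z 0 with rfl | hz
  · simp
  have hz' : ‖z‖ ≠ 0 := norm_ne_zero_iff.2 hz
  set S : EllP p 1 →L[ℝ] Z := (PiLp.proj p (fun _ : Fin 1 => ℝ) 0).smulRight (‖z‖⁻¹ • z) with hS
  have hSn : ‖S‖ ≤ 1 := by
    refine S.opNorm_le_bound zero_le_one fun a => ?_
    rw [hS, ContinuousLinearMap.smulRight_apply, norm_smul, norm_smul, norm_inv, norm_norm,
      inv_mul_cancel₀ hz', mul_one, one_mul]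
    exact PiLp.norm_apply_le a 0
  have h := hΦ 1 S hSn (PiLp.single p (0 : Fin 1) ‖z‖ ⊗ₜ y)
  rw [N.norm_tmul, PiLp.norm_single, norm_norm, TensorProduct.map_tmul] at h
  have e : S (PiLp.single p (0 : Fin 1) ‖z‖) = z := by
    simp [hS, smul_smul, hz']
  rw [ContinuousLinearMap.coe_coe, e] at h
  exact h.trans_eq (by ring)

/-- A functional norming the left-hand tensor is, on step functions, a contraction `T : ℓ^p_n →
ℓ^p_m`. Unwinding it turns the left side into `Φ` evaluated along the contraction `A.step p ∘ T`,
where the bound on `Φ` is available. -/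
theorem IsBoundedBy.projNorm_step_le {N : PMultinorm p Y} {C : ℝ}
    {Φ : Lp ℝ p μ ⊗[ℝ] Y →ₗ[ℝ] ℝ} (hΦ : N.IsBoundedBy C Φ) {m n : ℕ} (A : AtomFamily μ m)
    {κ : Type*} [Fintype κ] (a : κ → EllP p n) (y : κ → Y) :
    projNorm (∑ k, a k ⊗ₜ[ℝ] ∑ i, ((μ.real (A.set i))⁻¹ * slice Φ (y k) (A.ind p i)) • A.ind q i) ≤
      C * N.norm n (∑ k, a k ⊗ₜ y k) := by
  obtain ⟨B, hB, hBle⟩ := exists_functional_eq_projNorm (∑ k, a k ⊗ₜ[ℝ]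
    ∑ i, ((μ.real (A.set i))⁻¹ * slice Φ (y k) (A.ind p i)) • A.ind q i)
  obtain ⟨T, hT, hTa⟩ := A.exists_contraction B hBle
  have hST : ‖A.step p ∘L T‖ ≤ 1 :=
    ((A.step p).opNorm_comp_le T).trans (mul_le_one₀ (A.norm_step_le p) (norm_nonneg _) hT)
  refine le_trans (le_of_eq ?_) ((le_abs_self _).trans (hΦ n _ hST (∑ k, a k ⊗ₜ y k)))
  rw [← hB, map_sum, map_sum, map_sum]
  refine Finset.sum_congr rfl fun k _ => ?_
  rw [TensorProduct.map_tmul, LinearMap.id_apply, ContinuousLinearMap.coe_coe,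
    ContinuousLinearMap.comp_apply, A.step_apply, TensorProduct.tmul_sum, TensorProduct.sum_tmul,
    map_sum, map_sum]
  refine Finset.sum_congr rfl fun i _ => ?_
  rw [TensorProduct.tmul_smul, ← TensorProduct.smul_tmul', map_smul, map_smul, hTa, slice_apply,
    ← A.weight_mul_weight p q, smul_eq_mul, smul_eq_mul, mul_inv]
  ring

/-- On `D` the bounded densities are uniform limits of their averages over atoms; as `μ D` is
finite, the approximation also holds in `L^q`, and the bound for step functions passes over. -/
theorem IsBoundedBy.projNorm_truncation_le {N : PMultinorm p Y} {C : ℝ}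
    {Φ : Lp ℝ p μ ⊗[ℝ] Y →ₗ[ℝ] ℝ} (hΦ : N.IsBoundedBy C Φ) {n : ℕ}
    {κ : Type*} [Fintype κ] (a : κ → EllP p n) (y : κ → Y) {f : κ → Ω → ℝ}
    (hf : ∀ k, Measurable (f k)) {D : Set Ω} (hD : MeasurableSet D) (hμD : μ D ≠ ∞)
    (hfD : ∀ k, IsDensityOn (slice Φ (y k)) (f k) D) {M : ℝ} (hM : ∀ k, ∀ x ∈ D, |f k x| ≤ M)
    (g : κ → Lp ℝ q μ) (hg : ∀ k, g k =ᵐ[μ] D.indicator (f k)) :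
    projNorm (∑ k, a k ⊗ₜ[ℝ] g k) ≤ C * N.norm n (∑ k, a k ⊗ₜ y k) := by
  set W : ℝ := ∑ k, ‖a k‖ * μ.real D ^ (1 / q.toReal) with hW
  have hW0 : 0 ≤ W := by positivity
  refine le_of_forall_pos_le_add fun ε hε => ?_
  -- The total error is at most `W` times the uniform one; `W + 1` avoids dividing by zero.
  obtain ⟨m, A, hAD, hc, hA⟩ := exists_atomFamily_of_bounded (μ := μ) f hf hD hμD hM
    (show 0 < ε / (W + 1) by positivity)
  have hval : ∀ k i, ∫ x in A.set i, f k x ∂μ = slice Φ (y k) (A.ind p i) := fun k i =>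
    ((hfD k).apply_eq _ (A.measurableSet i) (A.ne_top i) (hAD i)).symm
  refine (projNorm_sum_tmul_le_add a g fun k =>
    ∑ i, ((μ.real (A.set i))⁻¹ * slice Φ (y k) (A.ind p i)) • A.ind q i).trans
    (add_le_add (hΦ.projNorm_step_le A a y) ?_)
  calc ∑ k, ‖a k‖ * ‖g k - ∑ i, ((μ.real (A.set i))⁻¹ * slice Φ (y k) (A.ind p i)) • A.ind q i‖
      ≤ ∑ k, ‖a k‖ * (ε / (W + 1) * μ.real D ^ (1 / q.toReal)) := by
        refine Finset.sum_le_sum fun k _ => mul_le_mul_of_nonneg_left ?_ (norm_nonneg _)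
        refine A.norm_sub_sum_avg_le hD hμD hAD hc (hg k) (by positivity) fun i x hx => ?_
        rw [← hval]
        exact hA k i x hx
    _ = ε * (W / (W + 1)) := by
        rw [hW, Finset.sum_div, Finset.mul_sum]
        refine Finset.sum_congr rfl fun k _ => ?_
        ring
    _ ≤ ε := mul_le_of_le_one_right hε.le ((div_le_one (by positivity)).2 (by linarith))

end PMultinorm

end

/-! ### Removing the truncation, and the extension. -/

noncomputable section

open MeasureTheory Set Filter Topology

section Truncation

variable {Ω : Type*} [MeasurableSpace Ω] {μ : Measure Ω} {q : ℝ≥0∞} [hq1 : Fact (1 ≤ q)]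

theorem tendsto_norm_sub_truncation (hq : q ≠ ∞) {D : ℕ → Set Ω} (hD : Monotone D)
    (hDm : ∀ n, MeasurableSet (D n)) (hc : ∀ᵐ x ∂μ, ∃ n, x ∈ D n) (g : Lp ℝ q μ)
    (h : ℕ → Lp ℝ q μ) (hh : ∀ n, h n =ᵐ[μ] (D n).indicator g) :
    Tendsto (fun n => ‖g - h n‖) atTop (𝓝 0) := by
  have hq0 : q ≠ 0 := (zero_lt_one.trans_le hq1.out).ne'
  have hq0' : 0 < q.toReal := ENNReal.toReal_pos hq0 hq
  have hdiff : ∀ n, (g - h n : Lp ℝ q μ) =ᵐ[μ] (D n)ᶜ.indicator g := by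
    intro n
    filter_upwards [Lp.coeFn_sub g (h n), hh n] with x h1 h2
    rw [h1, Pi.sub_apply, h2]
    by_cases hx : x ∈ D n <;> simp [hx]
  have hnorm : ∀ n, ‖g - h n‖ =
      ((∫⁻ x, ‖(D n)ᶜ.indicator g x‖ₑ ^ q.toReal ∂μ) ^ (1 / q.toReal)).toReal := by
    intro n
    rw [Lp.norm_def, eLpNorm_congr_ae (hdiff n), eLpNorm_eq_lintegral_rpow_enorm_toReal hq0 hq]
  have hgm : Measurable g := (Lp.stronglyMeasurable g).measurable
  have hfin : ∫⁻ x, ‖g x‖ₑ ^ q.toReal ∂μ ≠ ∞ :=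
    (lintegral_rpow_enorm_lt_top_of_eLpNorm_lt_top hq0 hq (Lp.memLp g).2).ne
  have hlim : Tendsto (fun n => ∫⁻ x, ‖(D n)ᶜ.indicator g x‖ₑ ^ q.toReal ∂μ) atTop
      (𝓝 (∫⁻ _, 0 ∂μ)) := by
    refine tendsto_lintegral_of_dominated_convergence (fun x => ‖g x‖ₑ ^ q.toReal)
      (fun n => ((hgm.indicator (hDm n).compl).enorm.pow_const _)) (fun n => ae_of_all _ fun x => ?_)
      hfin ?_
    · refine ENNReal.rpow_le_rpow ?_ hq0'.le
      by_cases hx : x ∈ D n <;> simp [hx]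
    · filter_upwards [hc] with x ⟨n, hn⟩
      refine tendsto_const_nhds.congr' ?_
      filter_upwards [eventually_ge_atTop n] with m hm
      rw [indicator_of_notMem (notMem_compl_iff.2 (hD hm hn)), enorm_zero, ENNReal.zero_rpow_of_pos hq0']
  rw [lintegral_zero] at hlim
  simp only [hnorm]
  have h1 := ((ENNReal.continuous_rpow_const (y := 1 / q.toReal)).tendsto 0).comp hlim
  rw [ENNReal.zero_rpow_of_pos (by positivity)] at h1
  exact (ENNReal.tendsto_toReal ENNReal.zero_ne_top).comp h1

/-- Truncations need not converge in `L^∞`, but their norms increase to `‖g‖`: any bound valid on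
every `D n` holds almost everywhere. -/
theorem tendsto_norm_truncation_top {D : ℕ → Set Ω} (hD : Monotone D)
    (hc : ∀ᵐ x ∂μ, ∃ n, x ∈ D n) (g : Lp ℝ ∞ μ)
    (h : ℕ → Lp ℝ ∞ μ) (hh : ∀ n, h n =ᵐ[μ] (D n).indicator g) :
    Tendsto (fun n => ‖h n‖) atTop (𝓝 ‖g‖) := by
  have hle : ∀ n, ‖h n‖ ≤ ‖g‖ := fun n => by
    refine Lp.norm_le_norm_of_ae_le ?_
    filter_upwards [hh n] with x hx
    rw [hx]
    exact norm_indicator_le_norm_self _ _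
  refine tendsto_atTop_isLUB (fun i j hij => ?_) ⟨?_, fun b hb => ?_⟩
  · refine Lp.norm_le_norm_of_ae_le ?_
    filter_upwards [hh i, hh j] with x hi hj
    rw [hi, hj]
    exact norm_indicator_le_of_subset (hD hij) _ _
  · rintro _ ⟨n, rfl⟩
    exact hle n
  · have hb0 : 0 ≤ b := (norm_nonneg _).trans (hb ⟨0, rfl⟩)
    rw [Lp.norm_def, eLpNorm_exponent_top]
    refine ENNReal.toReal_le_of_le_ofReal hb0 (eLpNormEssSup_le_of_ae_bound ?_)
    have hae : ∀ n, ∀ᵐ x ∂μ, ‖h n x‖ ≤ b := by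
      intro n
      filter_upwards [ae_le_eLpNormEssSup (f := h n) (μ := μ)] with x hx
      have h1 : ‖h n x‖ₑ ≤ ENNReal.ofReal b := by
        refine hx.trans ?_
        rw [← eLpNorm_exponent_top, ← Lp.enorm_def, ← ofReal_norm]
        exact ENNReal.ofReal_le_ofReal (hb ⟨n, rfl⟩)
      rwa [← ofReal_norm, ENNReal.ofReal_le_ofReal_iff hb0] at h1
    filter_upwards [hc, ae_all_iff.2 hae, ae_all_iff.2 hh] with x ⟨n, hn⟩ h1 h2
    have := h1 n
    rwa [h2 n, indicator_of_mem hn] at this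

end Truncation

section EllOne

variable {F : Type*} [NormedAddCommGroup F] [NormedSpace ℝ F] {n : ℕ}

/-- Regrouping along the unit vectors gives one half of the identification of the projective product
`ℓ^1_n ⊗ F` with `ℓ^1_n(F)`; the other half is `sum_norm_coord_le_projNorm`. -/
theorem projNorm_le_sum_norm_coord {κ : Type*} [Fintype κ] (a : κ → EllP 1 n) (x : κ → F) :
    projNorm (∑ k, a k ⊗ₜ[ℝ] x k) ≤ ∑ i, ‖∑ k, a k i • x k‖ := by
  have e : ∑ k, a k ⊗ₜ[ℝ] x k = ∑ i, (PiLp.single 1 i (1 : ℝ) : EllP 1 n) ⊗ₜ[ℝ]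
      ∑ k, a k i • x k := by
    simp only [TensorProduct.tmul_sum, ← TensorProduct.smul_tmul]
    rw [Finset.sum_comm]
    refine Finset.sum_congr rfl fun k _ => ?_
    rw [← TensorProduct.sum_tmul]
    congr 1
    ext j
    simp [Finset.sum_apply, Pi.single_apply]
  rw [e]
  refine (projNorm_sum_tmul_le _ _).trans_eq (Finset.sum_congr rfl fun i _ => ?_)
  rw [PiLp.norm_single, norm_one, one_mul]

theorem sum_norm_coord_le_projNorm {κ : Type*} [Fintype κ] (a : κ → EllP 1 n) (x : κ → F) :
    ∑ i, ‖∑ k, a k i • x k‖ ≤ projNorm (∑ k, a k ⊗ₜ[ℝ] x k) := by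
  let coord : Fin n → EllP 1 n ⊗[ℝ] F →ₗ[ℝ] F := fun i =>
    (TensorProduct.lid ℝ F).toLinearMap ∘ₗ
      TensorProduct.map (PiLp.proj 1 (fun _ : Fin n => ℝ) i).toLinearMap LinearMap.id
  have hcoord : ∀ i (b : EllP 1 n) (y : F), coord i (b ⊗ₜ y) = b i • y := fun i b y => by
    simp [coord]
  have key : ∀ w, ∑ i, ‖coord i w‖ ≤ projNorm w := by
    intro w
    refine le_csInf (projCosts_nonempty w) ?_
    rintro _ ⟨k, b, y, rfl, rfl⟩
    simp only [map_sum, hcoord]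
    calc ∑ i, ‖∑ j, b j i • y j‖ ≤ ∑ i, ∑ j, ‖b j i‖ * ‖y j‖ := by
          refine Finset.sum_le_sum fun i _ => (norm_sum_le _ _).trans_eq ?_
          simp only [norm_smul]
      _ = ∑ j, ‖b j‖ * ‖y j‖ := by
          rw [Finset.sum_comm]
          refine Finset.sum_congr rfl fun j _ => ?_
          rw [PiLp.norm_eq_of_L1, Finset.sum_mul]
  have := key (∑ k, a k ⊗ₜ[ℝ] x k)
  simpa only [map_sum, hcoord] using this

end EllOne

section

variable {Ω : Type*} [MeasurableSpace Ω] {μ : Measure Ω}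
  {p q : ℝ≥0∞} [Fact (1 ≤ p)] [Fact (1 ≤ q)] [p.HolderConjugate q]

/-- For `q < ∞` truncations converge in norm. For `q = ∞` one has `p = 1`, the projective norm is
the sum of the coordinate norms, and convergence of these norms is enough. -/
theorem projNorm_le_of_truncation {n : ℕ} {κ : Type*} [Fintype κ] (a : κ → EllP p n)
    (g : κ → Lp ℝ q μ) {D : ℕ → Set Ω} (hD : Monotone D)
    (hDm : ∀ n, MeasurableSet (D n)) (hc : ∀ᵐ x ∂μ, ∃ n, x ∈ D n)
    (h : ℕ → κ → Lp ℝ q μ) (hh : ∀ n k, h n k =ᵐ[μ] (D n).indicator (g k)) {K : ℝ}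
    (hK : ∀ n, projNorm (∑ k, a k ⊗ₜ[ℝ] h n k) ≤ K) : projNorm (∑ k, a k ⊗ₜ[ℝ] g k) ≤ K := by
  rcases eq_or_ne q ∞ with rfl | hq
  · obtain rfl : p = 1 := (ENNReal.HolderConjugate.eq_top_iff_eq_one ∞ p).1 rfl
    refine (projNorm_le_sum_norm_coord a g).trans ?_
    refine le_of_tendsto' (tendsto_finsetSum _ fun i _ =>
      tendsto_norm_truncation_top hD hc (∑ k, a k i • g k) (fun n => ∑ k, a k i • h n k) ?_)
      fun n => (sum_norm_coord_le_projNorm a (h n)).trans (hK n)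
    intro n
    have h1 : ∀ (f : κ → Lp ℝ ∞ μ), ∀ᵐ x ∂μ, ∀ k, (a k i • f k : Lp ℝ ∞ μ) x = a k i * f k x :=
      fun f => ae_all_iff.2 fun k => by
        filter_upwards [Lp.coeFn_smul (a k i) (f k)] with x hx
        rw [hx, Pi.smul_apply, smul_eq_mul]
    filter_upwards [h1 g, h1 (h n), Lp.coeFn_finset_sum Finset.univ fun k => a k i • g k,
      Lp.coeFn_finset_sum Finset.univ fun k => a k i • h n k, ae_all_iff.2 (hh n)]
      with x h2 h3 h4 h5 h6
    rw [h5]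
    by_cases hx : x ∈ D n
    · rw [indicator_of_mem hx, h4]
      refine Finset.sum_congr rfl fun k _ => ?_
      rw [h2, h3, h6, indicator_of_mem hx]
    · rw [indicator_of_notMem hx]
      refine Finset.sum_eq_zero fun k _ => ?_
      rw [h3, h6, indicator_of_notMem hx, mul_zero]
  · have hlim : Tendsto (fun n => K + ∑ k, ‖a k‖ * ‖g k - h n k‖) atTop
        (𝓝 (K + ∑ k, ‖a k‖ * 0)) :=
      tendsto_const_nhds.add (tendsto_finsetSum _ fun k _ => tendsto_const_nhds.mul
        (tendsto_norm_sub_truncation hq hD hDm hc (g k) (fun n => h n k) fun n => hh n k))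
    simp only [mul_zero, Finset.sum_const_zero, add_zero] at hlim
    refine ge_of_tendsto' hlim fun n => ?_
    exact (projNorm_sum_tmul_le_add a g (h n)).trans (add_le_add_left (hK n) _)

namespace PMultinorm

variable {Y : Type*} [NormedAddCommGroup Y] [NormedSpace ℝ Y] [CompleteSpace Y]

/-- The truncation bound for one elementary tensor over `ℓ^p_1` bounds the `L^q` norms of all
truncations by `C * ‖y‖`; Fatou's lemma then applies to `f`. -/
theorem IsBoundedBy.memLp_density [SigmaFinite μ] {N : PMultinorm p Y} {C : ℝ} (hC : 0 ≤ C)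
    {Φ : Lp ℝ p μ ⊗[ℝ] Y →ₗ[ℝ] ℝ} (hΦ : N.IsBoundedBy C Φ) {y : Y} {f : Ω → ℝ}
    (hf : IsDensity (slice Φ y) f) : MemLp f q μ := by
  obtain ⟨D, hD, hDm, hμD, hfD, hM, hc⟩ :=
    IsDensity.exists_common_exhaustion (κ := Unit) (fun _ => hf)
  have hmem : ∀ n, MemLp ((D n).indicator f) q μ := fun n =>
    memLp_of_bounded_on hf.measurable (hDm n) (hμD n) (hM n ())
  have hb : ∀ n, eLpNorm ((D n).indicator f) q μ ≤ ENNReal.ofReal (C * ‖y‖) := by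
    intro n
    have h1 := hΦ.projNorm_truncation_le (q := q) (κ := Unit)
      (fun _ => (PiLp.single p 0 1 : EllP p 1)) (fun _ => y) (fun _ => hf.measurable) (hDm n)
      (hμD n) (hfD n) (hM n) (fun _ => (hmem n).toLp _) (fun _ => (hmem n).coeFn_toLp)
    simp only [Finset.univ_unique, Finset.sum_singleton] at h1
    rw [projNorm_tmul, N.norm_tmul, PiLp.norm_single, norm_one, one_mul, one_mul,
      Lp.norm_toLp] at h1
    exact (ENNReal.le_ofReal_iff_toReal_le (hmem n).2.ne (by positivity)).2 h1
  refine ⟨hf.measurable.aestronglyMeasurable, ?_⟩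
  refine lt_of_le_of_lt (Lp.eLpNorm_lim_le_liminf_eLpNorm (fun n => (hmem n).1) f ?_) ?_
  · filter_upwards [hc] with x ⟨n, hn⟩
    refine tendsto_const_nhds.congr' ?_
    filter_upwards [eventually_ge_atTop n] with m hm
    rw [indicator_of_mem (hD hm hn)]
  · refine lt_of_le_of_lt ?_ (ENNReal.ofReal_lt_top (r := C * ‖y‖))
    exact (liminf_le_liminf (Eventually.of_forall hb)).trans_eq (liminf_const _)

/-- The linear map into `L^q` whose values are the densities of the slices of a bounded
functional. -/
theorem IsBoundedBy.exists_linearMap [SigmaFinite μ] {N : PMultinorm p Y} {C : ℝ} (hC : 0 ≤ C)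
    {Φ : Lp ℝ p μ ⊗[ℝ] Y →ₗ[ℝ] ℝ} (hΦ : N.IsBoundedBy C Φ) :
    ∃ U : Y →ₗ[ℝ] Lp ℝ q μ, (∀ y, IsDensity (slice Φ y) (U y)) ∧
      ∀ n (t : EllP p n ⊗[ℝ] Y), projNorm (ampl p n U t) ≤ C * N.norm n t := by
  have hex : ∀ y, ∃ g : Lp ℝ q μ, IsDensity (slice Φ y) g := by
    intro y
    obtain ⟨f, hf⟩ := exists_isDensity (slice Φ y) (hΦ.abs_slice_le y) (by positivity)
    have hmem : MemLp f q μ := hΦ.memLp_density hC hf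
    exact ⟨hmem.toLp f, hf.congr_ae (Lp.stronglyMeasurable _).measurable hmem.coeFn_toLp.symm⟩
  choose G hG using hex
  let U : Y →ₗ[ℝ] Lp ℝ q μ :=
    { toFun := G
      map_add' := fun y y' => by
        refine Lp.ext ?_
        have h1 := hG (y + y')
        rw [slice_add] at h1
        exact (h1.ae_eq ((hG y).add (hG y'))).trans (Lp.coeFn_add _ _).symm
      map_smul' := fun c y => by
        refine Lp.ext ?_
        have h1 := hG (c • y)
        rw [slice_smul] at h1
        exact (h1.ae_eq ((hG y).smul c)).trans (Lp.coeFn_smul _ _).symm }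
  refine ⟨U, hG, fun n t => ?_⟩
  obtain ⟨K, a, y, rfl⟩ := TensorProduct.exists_sum_tmul_eq t
  have e : ampl p n U (∑ k, a k ⊗ₜ y k) = ∑ k, a k ⊗ₜ[ℝ] G (y k) := by
    rw [map_sum]; rfl
  rw [e]
  obtain ⟨D, hD, hDm, hμD, hfD, hM, hc⟩ :=
    IsDensity.exists_common_exhaustion (fun k => hG (y k))
  have hmem : ∀ n k, MemLp ((D n).indicator (G (y k))) q μ := fun n k =>
    (Lp.memLp _).indicator (hDm n)
  exact projNorm_le_of_truncation a (fun k => G (y k)) hD hDm hc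
    (fun j k => (hmem j k).toLp _) (fun j k => (hmem j k).coeFn_toLp) fun j =>
      hΦ.projNorm_truncation_le a y (fun k => (hG (y k)).measurable) (hDm j) (hμD j) (hfD j)
        (hM j) _ fun k => (hmem j k).coeFn_toLp

section PNorm

variable {X : Type*} [NormedAddCommGroup X] [NormedSpace ℝ X] [CompleteSpace X]

theorem norm_ampl_le {NX : PMultinorm p X} {NY : PMultinorm p Y} {u : X →ₗ[ℝ] Y}
    (hu : IsMultibounded NX NY u) (n : ℕ) (t : EllP p n ⊗[ℝ] X) :
    NY.norm n (ampl p n u t) ≤ (pNorm NX NY u).toReal * NX.norm n t := by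
  have h1 : ∀ s : EllP p n ⊗[ℝ] X, NX.norm n s ≤ 1 →
      NY.norm n (ampl p n u s) ≤ (pNorm NX NY u).toReal := by
    intro s hs
    rw [← ENNReal.ofReal_le_iff_le_toReal hu.ne]
    exact le_iSup_of_le n (le_iSup_of_le s (le_iSup_of_le hs le_rfl))
  rcases (apply_nonneg (NX.norm n) t).eq_or_lt with h0 | h0
  -- A tensor of norm zero cannot be rescaled to the unit sphere; it is handled by the separation of
  -- points.
  · rw [NX.eq_zero_of_norm_eq_zero n t h0.symm]
    simp
  · have h2 := h1 ((NX.norm n t)⁻¹ • t) (by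
      rw [map_smul_eq_mul, norm_inv, Real.norm_of_nonneg h0.le, inv_mul_cancel₀ h0.ne'])
    rw [map_smul, map_smul_eq_mul, norm_inv, Real.norm_of_nonneg h0.le, inv_mul_le_iff₀ h0] at h2
    rwa [mul_comm]

theorem pNorm_le {NX : PMultinorm p X} {NY : PMultinorm p Y} {u : X →ₗ[ℝ] Y} {C : ℝ} (hC : 0 ≤ C)
    (h : ∀ n t, NY.norm n (ampl p n u t) ≤ C * NX.norm n t) :
    pNorm NX NY u ≤ ENNReal.ofReal C :=
  iSup_le fun n => iSup_le fun t => iSup_le fun ht =>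
    ENNReal.ofReal_le_ofReal ((h n t).trans (mul_le_of_le_one_right hC ht))

end PNorm

end PMultinorm

end

end
theorem mainTheorem12 {Ω : Type w} [MeasurableSpace Ω] (μ : MeasureTheory.Measure Ω)
    [MeasureTheory.SigmaFinite μ] (p p' : ℝ≥0∞) [Fact (1 ≤ p)] [Fact (1 ≤ p')]
    (hpp' : p.HolderConjugate p') :
    PMultinorm.IsInjective.{v, w}
      (PMultinorm.maxStructure p (MeasureTheory.Lp ℝ p' μ)) 1 := by
  intro Y _ _ _ N X _ u hu
  set C := (PMultinorm.pNorm (N.restrict X)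
    (PMultinorm.maxStructure p (MeasureTheory.Lp ℝ p' μ)) u).toReal with hCdef
  have hC : 0 ≤ C := ENNReal.toReal_nonneg
  obtain ⟨Φ, hΦ, hΦN⟩ := N.exists_functional_extension X u hC (PMultinorm.norm_ampl_le hu)
  obtain ⟨U, hU, hUN⟩ := PMultinorm.IsBoundedBy.exists_linearMap (q := p') hC hΦN
  refine ⟨U, ?_, fun x => MeasureTheory.Lp.ext ?_⟩
  · refine (PMultinorm.pNorm_le hC hUN).trans_eq ?_
    rw [hCdef, ENNReal.ofReal_toReal hu.ne, ENNReal.coe_one, one_mul]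
  -- Both `U x` and `u x` are densities of the slice of `Φ` at `x`.
  · exact (hU x).ae_eq (IsDensity.of_lp _ (u x) fun s hs hμ => hΦ s hs hμ x)
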